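/- **Setting.** For $i=1,\dots,N$ let $\mathcal M^i=(\mathcal S^i,s_I^i,\mathcal A^i,\mathcal T^i)$ be a finite Markov decision process. Put $\boldsymbol{\mathcal S}=\prod_i\mathcal S^i$, $\boldsymbol{\mathcal A}=\prod_i\mathcal A^i$, $\boldsymbol s_I=(s_I^1,\dots,s_I^N)$, and $\boldsymbol{\mathcal T}(\boldsymbol s,\boldsymbol a,\boldsymbol y)=\prod_i\mathcal T^i(s^i,a^i,y^i)$. Let $\pi:\boldsymbol{\mathcal S}\to\Delta(\boldsymbol{\mathcal A})$ be a stationary joint policy and $\mathcal S_{\mathcal T},\mathcal S_{\mathcal A}\subseteq\boldsymbol{\mathcal S}$ (target and avoid sets). A joint path $\boldsymbol s_0\boldsymbol a_0\boldsymbol s_1\boldsymbol a_1\dots$ *succeeds* if there is $M$ with $\boldsymbol s_M\in\mathcal S_{\mathcal T}$ and $\boldsymbol s_t\notin\mathcal S_{\mathcal A}$ for all $t<M$. *Full communication.* $\Gamma^{full}$ is the law of the joint path with $\boldsymbol s_0=\boldsymbol s_I$, $\boldsymbol a_t\sim\pi(\boldsymbol s_t)$, $\boldsymbol s_{t+1}\sim\boldsymbol{\mathcal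 T}(\boldsymbol s_t,\boldsymbol a_t)$; $v^{full}$ is its success probability. *Imaginary play.* Communication is available exactly at the times $t<t_{loss}$, where $t_{loss}\in\{0,1,\dots\}\cup\{\infty\}$. At every time each agent $i$ holds a joint state $\hat{\boldsymbol s}_{t,i}$ whose $i$-th entry is its true state $s^i_t$, and a joint action $\hat{\boldsymbol a}_{t,i}$ whose $i$-th entry is the action it executes. While communication is available, the true states move by $\boldsymbol{\mathcal T}$, $\hat{\boldsymbol s}_{t,i}=\boldsymbol s_t$ for all $i$, and all agents use one common $\boldsymbol a_t\sim\pi(\boldsymbol s_t)$. For $t\ge t_{loss}$, independently for every agent $i$, $\hat{\boldsymbol s}_{t,i}\sim\boldsymbol{\mathcal T}(\hat{\boldsymbol s}_{t-1,i},\hat{\boldsymbol a}_{t-1,i})$ (if $t=0$: $\hat{\boldsymbol s}_{0,i}=\boldsymbol s_I$) and $\hat{\boldsymbol a}_{t,i}\sim\pi(\hat{\boldsymbol s}_{t,i})$. If $t_{loss}$ is random, it is independent of all of these draws; $v^{img}$ is the probability that the path of true joint states and executed actions succeeds. *Total correlation.* For the random joint path $\boldsymbol X=(X^1,\dots,X^N)\sim\Gamma^{full}$,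 where $X^i=s^i_0a^i_0s^i_1a^i_1\dots$, let $C_\pi=\sum_iH(X^i)-H(\boldsymbol X)\in[0,\infty]$, with Shannon entropy in nats; precisely, $C_\pi=\sup_T\big(\sum_iH(X^i_{<T})-H(\boldsymbol X_{<T})\big)$, where $X_{<T}$ consists of the first $T$ state-action pairs. (The expression is nondecreasing in $T$.) Put $\exp(-\infty)=0$. *Path length.* Let $\mathcal S_{\mathcal D}$ be the set of joint states from which, under $\pi$ with full communication, $\mathcal S_{\mathcal T}$ is reached with probability $0$; or, alternatively, the set of those from which success has probability $0$. Let $len=\min\{t+1:\boldsymbol s_t\in\mathcal S_{\mathcal T}\cup\mathcal S_{\mathcal D}\}$ and $l^{full}=\mathbb E_{\Gamma^{full}}[len]$. **Theorem.** Let $p\in[0,1]$ and $\Pr(t_{loss}=t)=(1-p)^tp$ for $t=0,1,2,\dots$ (so that $t_{loss}=\infty$ almost surely if $p=0$). Then, for either choice of $\mathcal S_{\mathcal D}$, $l^{full}<\infty$ and $$v^{img}\ \ge\ \max\Big(v^{full}-\sqrt{1-\exp(-C_\pi)},\ \ v^{full}\,(1-p)^{l^{full}/v^{full}}\Big),$$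 where the second term is read as $0$ if $v^{full}=0$. -/

import Mathlib

open MeasureTheory ProbabilityTheory
open scoped ENNReal

noncomputable section

namespace ImaginaryPlay

universe u v

/-! ### Discrete probability: product distributions and path laws -/

/-- The product of finitely many probability distributions on finite sets:
independent coordinates, `y ↦ ∏ i, q i (y i)`. -/
def pmfPi {ι : Type*} [Fintype ι] [DecidableEq ι] {α : ι → Type*} [∀ i, Fintype (α i)]
    (q : ∀ i, PMF (α i)) : PMF (∀ i, α i) :=
  PMF.ofFintype (fun y => ∏ i, q i (y i)) (by
    rw [← Fintype.prod_sum]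
    refine Finset.prod_eq_one fun i _ => ?_
    rw [← tsum_fintype (L := .unconditional _)]
    exact (q i).tsum_coe)

/-- The law, on infinite paths `x₀ x₁ x₂ …`, of the (time-dependent) Markov chain on a finite
set with initial distribution `init` and in which `x_{n+1}` has distribution `step n x_n`
given `x₀, …, x_n`. -/
def chainLaw {X : Type*} [Fintype X] [MeasurableSpace X] [MeasurableSingletonClass X]
    (init : PMF X) (step : ℕ → X → PMF X) : Measure (ℕ → X) :=
  let κ : ∀ n : ℕ, Kernel (∀ _ : Finset.Iic n, X) X := fun n =>
    Kernel.ofFunOfCountable fun h => (step n (h ⟨n, Finset.mem_Iic.2 le_rfl⟩)).toMeasure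
  haveI : ∀ n, IsMarkovKernel (κ n) := fun n => ⟨fun h => by
    change IsProbabilityMeasure (PMF.toMeasure _)
    infer_instance⟩
  ∑ x : X, init x • Kernel.traj (X := fun _ => X) κ 0 (fun _ => x)

/-- Shannon entropy (natural logarithm) of the random variable `f` with values in a finite set,
under the measure `μ`. -/
def entropy {Ω α : Type*} [MeasurableSpace Ω] [Fintype α] (μ : Measure Ω) (f : Ω → α) : ℝ :=
  ∑ x : α, Real.negMulLog (μ.real (f ⁻¹' {x}))

/-! ### The cooperative Markov game -/

/-- A Markov decision process with state set `S` and action set `A`. -/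
structure MDP (S : Type u) (A : Type v) where
  /-- the initial state -/
  init : S
  /-- the transition probabilities -/
  trans : S → A → PMF S

variable {N : ℕ} {S : Fin N → Type u} {A : Fin N → Type v}

/-- A joint state together with a joint action: one entry of a joint path. -/
abbrev StateAction (S : Fin N → Type u) (A : Fin N → Type v) : Type (max u v) :=
  (∀ i, S i) × (∀ i, A i)

/-- The joint initial state. -/
def jointInit (G : ∀ i, MDP (S i) (A i)) : ∀ i, S i := fun i => (G i).init

/-- The joint transition function `𝒯(s, a, y) = ∏ i, 𝒯ⁱ(sⁱ, aⁱ, yⁱ)`. -/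
def jointTrans [∀ i, Fintype (S i)] (G : ∀ i, MDP (S i) (A i)) (x : StateAction S A) :
    PMF (∀ i, S i) :=
  pmfPi fun i => (G i).trans (x.1 i) (x.2 i)

/-- Draw a joint action from the joint policy `π` at the joint state `s`; return both. -/
def drawAction (π : (∀ i, S i) → PMF (∀ i, A i)) (s : ∀ i, S i) : PMF (StateAction S A) :=
  (π s).map fun a => (s, a)

/-- One step of the Markov chain of state-action pairs induced by the joint policy: move to a new
joint state, then draw a new joint action there. -/
def jointStep [∀ i, Fintype (S i)] (G : ∀ i, MDP (S i) (A i))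
    (π : (∀ i, S i) → PMF (∀ i, A i)) (x : StateAction S A) : PMF (StateAction S A) :=
  (jointTrans G x).bind (drawAction π)

/-! ### Imaginary play -/

/-- What the agents hold at one time step: `r i` is agent `i`'s version `(ŝ_i, â_i)` of the joint
state and of the joint action. Its `i`-th components are agent `i`'s true state and the action
that it really executes; its other components are its imaginary teammates. -/
abbrev Record (S : Fin N → Type u) (A : Fin N → Type v) : Type (max u v) :=
  Fin N → StateAction S A

/-- The true joint state and the executed joint action. -/
def actual (r : Record S A) : StateAction S A :=
  (fun i => (r i).1 i, fun i => (r i).2 i)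

/-- Time `0`. With communication, one joint action is drawn and shared. Without, every agent
`i` puts its teammates at their initial states and draws its own `â_i`, independently. -/
def imgInit [∀ i, Fintype (S i)] [∀ i, Fintype (A i)] (G : ∀ i, MDP (S i) (A i))
    (π : (∀ i, S i) → PMF (∀ i, A i)) (comm : Prop) [Decidable comm] : PMF (Record S A) :=
  if comm then (drawAction π (jointInit G)).map fun x _ => x
  else pmfPi fun _ => drawAction π (jointInit G)

/-- The next time step. With communication (at the new time), the true states move, they are
shared, and one joint action is drawn from the policy at the true joint state and shared.
Without, independently for every agent `i`: all states in agent `i`'s version move (its own true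
state by its executed action, its imaginary teammates by their imagined actions) and agent `i`
draws a joint action from the policy at its own version of the joint state. -/
def imgStep [∀ i, Fintype (S i)] [∀ i, Fintype (A i)] (G : ∀ i, MDP (S i) (A i))
    (π : (∀ i, S i) → PMF (∀ i, A i)) (comm : Prop) [Decidable comm] (r : Record S A) :
    PMF (Record S A) :=
  if comm then (jointStep G π (actual r)).map fun x _ => x
  else pmfPi fun i => jointStep G π (r i)

section Laws

variable [∀ i, Fintype (S i)] [∀ i, MeasurableSpace (S i)] [∀ i, MeasurableSingletonClass (S i)]
  [∀ i, Fintype (A i)] [∀ i, MeasurableSpace (A i)] [∀ i, MeasurableSingletonClass (A i)]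

/-- The law of the joint path under the joint policy with full communication, from the joint
state `s`. -/
def fullLawFrom (G : ∀ i, MDP (S i) (A i)) (π : (∀ i, S i) → PMF (∀ i, A i))
    (s : ∀ i, S i) : Measure (ℕ → StateAction S A) :=
  chainLaw (drawAction π s) fun _ => jointStep G π

/-- The law of the joint path under the joint policy with full communication. -/
def fullLaw (G : ∀ i, MDP (S i) (A i)) (π : (∀ i, S i) → PMF (∀ i, A i)) :
    Measure (ℕ → StateAction S A) :=
  fullLawFrom G π (jointInit G)

open Classical in
/-- The law of the true joint path under imaginary play, when communication is available exactly
at the times `t < tloss`. -/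
def imgLawAt (G : ∀ i, MDP (S i) (A i)) (π : (∀ i, S i) → PMF (∀ i, A i)) (tloss : ℕ∞) :
    Measure (ℕ → StateAction S A) :=
  (chainLaw (imgInit G π ((0 : ℕ∞) < tloss))
    fun n => imgStep G π (((n + 1 : ℕ) : ℕ∞) < tloss)).map fun ω t => actual (ω t)

/-- The law of the true joint path under imaginary play, when the time of the communication loss
is random with distribution `τ` (independent of the agents). -/
def imgLaw (G : ∀ i, MDP (S i) (A i)) (π : (∀ i, S i) → PMF (∀ i, A i)) (τ : PMF ℕ∞) :
    Measure (ℕ → StateAction S A) :=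
  Measure.sum fun t : ℕ∞ => τ t • imgLawAt G π t

/-! ### Reach-avoid value, path length, total correlation -/

/-- The joint paths that are in `target` at some time and not in `avoid` at any earlier time. -/
def Success (target avoid : Set (∀ i, S i)) : Set (ℕ → StateAction S A) :=
  {ω | ∃ M, (ω M).1 ∈ target ∧ ∀ t < M, (ω t).1 ∉ avoid}

/-- The joint states from which `target` is reached with probability `0` under the policy. -/
def deadReach (G : ∀ i, MDP (S i) (A i)) (π : (∀ i, S i) → PMF (∀ i, A i))
    (target : Set (∀ i, S i)) : Set (∀ i, S i) :=
  {s | fullLawFrom G π s {ω | ∃ t, (ω t).1 ∈ target} = 0}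

/-- The joint states from which the reach-avoid task succeeds with probability `0` under the
policy. -/
def deadReachAvoid (G : ∀ i, MDP (S i) (A i)) (π : (∀ i, S i) → PMF (∀ i, A i))
    (target avoid : Set (∀ i, S i)) : Set (∀ i, S i) :=
  {s | fullLawFrom G π s (Success target avoid) = 0}

/-- The length `min {t + 1 | s_t ∈ B}` of a joint path (`∞` if it never meets `B`). -/
def pathLength (B : Set (∀ i, S i)) (ω : ℕ → StateAction S A) : ℝ≥0∞ :=
  ⨅ (t : ℕ) (_ : (ω t).1 ∈ B), ((t + 1 : ℕ) : ℝ≥0∞)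

/-- The expected path length, up to `target ∪ dead`, under full communication. -/
def expectedLength (G : ∀ i, MDP (S i) (A i)) (π : (∀ i, S i) → PMF (∀ i, A i))
    (target dead : Set (∀ i, S i)) : ℝ≥0∞ :=
  ∫⁻ ω, pathLength (target ∪ dead) ω ∂(fullLaw G π)

/-- `∑ i, H(Xⁱ) - H(X)` for the first `T` entries `s₀ a₀ … s_{T-1} a_{T-1}` of the joint path under
full communication. -/
def totalCorrelationUpTo (G : ∀ i, MDP (S i) (A i)) (π : (∀ i, S i) → PMF (∀ i, A i))
    (T : ℕ) : ℝ :=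
  (∑ i : Fin N, entropy (fullLaw G π)
      fun (ω : ℕ → StateAction S A) (t : Fin T) => ((ω t).1 i, (ω t).2 i))
    - entropy (fullLaw G π) fun (ω : ℕ → StateAction S A) (t : Fin T) => ω t

/-- The total correlation of the joint policy, in `[0, ∞]`. The total correlation of the first `T`
entries is nondecreasing in `T`, so the supremum is its limit; it equals `∑ i, H(Xⁱ) - H(X)` for
the infinite paths whenever `H(X)` is finite, and the Kullback-Leibler divergence of the law of
the joint path from the product of the laws of the individual paths in all cases. -/
def totalCorrelation (G : ∀ i, MDP (S i) (A i)) (π : (∀ i, S i) → PMF (∀ i, A i)) : EReal :=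
  ⨆ T : ℕ, (totalCorrelationUpTo G π T : EReal)

end Laws

end ImaginaryPlay

end

/-!
Both lower bounds compare the law of the joint path under imaginary play with the law `fullLaw`
under full communication, and use that a Markov chain restarts at its first step
(`chainLaw_eq_cons`). This reduces everything to finite sums over path prefixes.

*Total correlation.* Fix the time `k` at which communication is lost. The divergence of the first
`T` entries under full communication from those under imaginary play is at most their total
correlation (`kl_le_tc`), by induction on `T`. If `k = 0`, the agents move independently from the
start, the law of imaginary play is the product of the marginal laws of the agents' paths
(`prefixProb_imgPathLaw_zero`), and the divergence from it is the total correlation. If `k > 0`, the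
first entry is shared; conditionally on it, what is left is imaginary play with one step less of
communication (`imgPathLaw_cons`), and the mean conditional total correlation given the first entry
is at most the total correlation (`sum_mul_tc_le`), since entropy is subadditive and decreases under
conditioning. The Bretagnolle-Huber inequality (`sub_le_sqrt_one_sub_exp_neg_kl`) then bounds the
loss in the probability of success before time `T`; let `T` tend to infinity and average over `k`.

*Path length.* Split success according to the time `n` of the first visit to the target
(`hitAt`). Up to the loss of communication imaginary play has the law of full communication, so the
part `n` keeps its probability `w n` whenever communication lasts beyond time `n`, which has
probability `(1 - p) ^ (n + 1)`. Hence imaginary play succeeds with probability at least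
`∑ w n * (1 - p) ^ (n + 1)`. Almost no path succeeds after a visit to a dead state
(`fullLawFrom_dead_success`), so the path length is `n + 1` on part `n` and `∑ w n * (n + 1)` is at
most the expected length (`tsum_hitAt_mul_le_expectedLength`). Jensen's inequality for
`x ↦ (1 - p) ^ x` finishes the proof (`mul_rpow_le_of_hasSum`). The expected length is finite
because the state space is finite: within some fixed number of steps, the chain meets the target or a dead
state with probability bounded below (`lintegral_pathLength_ne_top`).
-/

namespace ImaginaryPlay

/-! ### Laws of Markov chains -/

/-- The path that starts at `x` and continues as `ω`. -/
def pathCons {X : Type*} (x : X) (ω : ℕ → X) : ℕ → X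
  | 0 => x
  | n + 1 => ω n

@[simp] lemma pathCons_zero {X : Type*} (x : X) (ω : ℕ → X) : pathCons x ω 0 = x := rfl

@[simp] lemma pathCons_succ {X : Type*} (x : X) (ω : ℕ → X) (n : ℕ) :
    pathCons x ω (n + 1) = ω n := rfl

lemma measurable_pathCons {X : Type*} [MeasurableSpace X] (x : X) : Measurable (pathCons x) := by
  refine measurable_pi_lambda _ fun n => ?_
  cases n with
  | zero => exact measurable_const
  | succ n => exact measurable_pi_apply n

lemma measurableSet_cyl {X : Type*} [MeasurableSpace X]
    [MeasurableSingletonClass X] (T : ℕ) (x : ℕ → X) :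
    MeasurableSet {ω : ℕ → X | ∀ t < T, ω t = x t} := by
  have : {ω : ℕ → X | ∀ t < T, ω t = x t} = ⋂ t, ⋂ (_ : t < T), (fun ω => ω t) ⁻¹' {x t} := by
    ext; simp
  rw [this]
  exact MeasurableSet.iInter fun t => MeasurableSet.iInter fun _ =>
    measurable_pi_apply t (measurableSet_singleton _)

section Chain

variable {X : Type*} [Fintype X] [MeasurableSpace X] [MeasurableSingletonClass X]

/-- The transition kernel of a time-dependent Markov chain, as a function of the whole history. -/
noncomputable def chainKernel (step : ℕ → X → PMF X) (n : ℕ) :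
    Kernel (∀ _ : Finset.Iic n, X) X :=
  Kernel.ofFunOfCountable fun h => (step n (h ⟨n, Finset.mem_Iic.2 le_rfl⟩)).toMeasure

instance (step : ℕ → X → PMF X) (n : ℕ) : IsMarkovKernel (chainKernel step n) :=
  ⟨fun h => by
    change IsProbabilityMeasure (PMF.toMeasure _)
    infer_instance⟩

lemma chainLaw_eq_sum_traj (init : PMF X) (step : ℕ → X → PMF X) :
    chainLaw init step = ∑ x : X, init x •
      Kernel.traj (X := fun _ => X) (chainKernel step) 0 (fun _ => x) := rfl

instance isProbabilityMeasure_chainLaw (init : PMF X) (step : ℕ → X → PMF X) :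
    IsProbabilityMeasure (chainLaw init step) := by
  constructor
  rw [chainLaw_eq_sum_traj, Measure.finsetSum_apply]
  simp only [Measure.smul_apply, measure_univ, smul_eq_mul, mul_one]
  rw [← tsum_fintype (L := .unconditional _)]
  exact init.tsum_coe

/-- A trajectory that continues the history `h` almost surely extends `h`. -/
lemma traj_self_ae (step : ℕ → X → PMF X) (n : ℕ) (h : ∀ _ : Finset.Iic n, X) :
    ∀ᵐ ω ∂(Kernel.traj (X := fun _ => X) (chainKernel step) n h), Preorder.frestrictLe n ω = h := by
  have h1 := Kernel.traj_map_frestrictLe_apply (X := fun _ => X) (κ := chainKernel step) n n h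
  rw [Kernel.partialTraj_self, Kernel.id_apply] at h1
  have h2 : ∀ᵐ y ∂((Kernel.traj (X := fun _ => X) (chainKernel step) n h).map
      (Preorder.frestrictLe n)), y = h := by
    rw [h1, ae_dirac_eq]; rfl
  exact ae_of_ae_map (Preorder.measurable_frestrictLe n).aemeasurable h2

lemma traj_cyl (step : ℕ → X → PMF X) (n : ℕ) (x₀ : X) (x : ℕ → X) :
    Kernel.traj (X := fun _ => X) (chainKernel step) 0 (fun _ => x₀)
        {ω | ∀ t < n + 1, ω t = x t} =
      ({x 0} : Set X).indicator 1 x₀ * ∏ t ∈ Finset.range n, step t (x t) (x (t + 1)) := by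
  classical
  induction n with
  | zero =>
    have := traj_self_ae step 0 (fun _ => x₀)
    have h0 : ∀ᵐ ω ∂(Kernel.traj (X := fun _ => X) (chainKernel step) 0 (fun _ => x₀)),
        ω 0 = x₀ := by
      filter_upwards [this] with ω hω
      exact congrFun hω ⟨0, by simp⟩
    have h1 : {ω : ℕ → X | ∀ t < 0 + 1, ω t = x t} =ᵐ[
        Kernel.traj (X := fun _ => X) (chainKernel step) 0 (fun _ => x₀)]
        {_ω | x₀ = x 0} := by
      filter_upwards [h0] with ω hω
      apply propext
      change (∀ t < 0 + 1, ω t = x t) ↔ x₀ = x 0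
      simp [hω]
    rw [measure_congr h1]
    by_cases hx : x₀ = x 0 <;> simp [hx]
  | succ n ih =>
    have hm := measurableSet_cyl (n + 2) x
    rw [← Kernel.traj_comp_partialTraj (X := fun _ => X) (κ := chainKernel step) (Nat.zero_le n),
      Kernel.comp_apply' _ _ _ hm]
    have key : ∀ h : (∀ _ : Finset.Iic n, X),
        Kernel.traj (X := fun _ => X) (chainKernel step) n h {ω | ∀ t < n + 2, ω t = x t} =
          ({Preorder.frestrictLe n x} : Set (∀ _ : Finset.Iic n, X)).indicator
            (fun _ => step n (x n) (x (n + 1))) h := by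
      intro h
      have hae := traj_self_ae step n h
      by_cases hx : h = Preorder.frestrictLe n x
      · rw [Set.indicator_of_mem (by simpa using hx)]
        have h1 : {ω : ℕ → X | ∀ t < n + 2, ω t = x t} =ᵐ[
            Kernel.traj (X := fun _ => X) (chainKernel step) n h]
            (fun ω => ω (n + 1)) ⁻¹' {x (n + 1)} := by
          filter_upwards [hae] with ω hω
          apply propext
          change (∀ t < n + 2, ω t = x t) ↔ ω (n + 1) = x (n + 1)
          refine ⟨fun H => H _ (by omega), fun H t ht => ?_⟩
          rcases Nat.lt_or_ge t (n + 1) with h2 | h2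
          · exact congrFun (hω.trans hx) ⟨t, by simp; omega⟩
          · obtain rfl : t = n + 1 := by omega
            exact H
        rw [measure_congr h1, ← Measure.map_apply (measurable_pi_apply _)
          (measurableSet_singleton _), ← Kernel.map_apply _ (measurable_pi_apply _),
          Kernel.map_traj_succ_self]
        change (step n (h ⟨n, _⟩)).toMeasure {x (n + 1)} = _
        rw [PMF.toMeasure_apply_singleton _ _ (measurableSet_singleton _), hx]
        rfl
      · rw [Set.indicator_of_notMem (by simpa using hx)]
        refine measure_mono_null (t := {ω | ¬ Preorder.frestrictLe n ω = h}) ?_ hae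
        intro ω hω h3
        refine hx ?_
        rw [← h3]
        ext t
        exact hω t (by have := Finset.mem_Iic.1 t.2; omega)
    simp_rw [key]
    rw [lintegral_indicator (measurableSet_singleton _), setLIntegral_const,
      ← Kernel.traj_map_frestrictLe,
      Kernel.map_apply' _ (by fun_prop) _ (measurableSet_singleton _),
      Finset.prod_range_succ, ← mul_assoc, ← ih, mul_comm]
    congr 2
    ext ω
    simp only [Set.mem_preimage, Set.mem_singleton_iff, funext_iff, Set.mem_ofPred_eq]
    constructor
    · intro H t ht
      exact H ⟨t, by simp; omega⟩
    · intro H t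
      exact H t (by have := Finset.mem_Iic.1 t.2; omega)

lemma chainLaw_cyl (init : PMF X) (step : ℕ → X → PMF X) (n : ℕ) (x : ℕ → X) :
    chainLaw init step {ω | ∀ t < n + 1, ω t = x t} =
      init (x 0) * ∏ t ∈ Finset.range n, step t (x t) (x (t + 1)) := by
  classical
  rw [chainLaw_eq_sum_traj, Measure.finsetSum_apply]
  simp only [Measure.smul_apply, smul_eq_mul, traj_cyl]
  rw [Finset.sum_eq_single (x 0)]
  · simp
  · intro b _ hb
    simp [hb]
  · simp

/-- Finite measures on path space that agree on all cylinders are equal. -/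
lemma measure_path_ext {μ ν : Measure (ℕ → X)} [IsFiniteMeasure μ] [IsFiniteMeasure ν]
    (h : ∀ (n : ℕ) (x : ℕ → X), μ {ω | ∀ t < n + 1, ω t = x t} = ν {ω | ∀ t < n + 1, ω t = x t}) :
    μ = ν := by
  classical
  refine IsProjectiveLimit.unique (P := fun I : Finset ℕ => μ.map I.restrict) (fun I => rfl) ?_
  have hp : IsProjectiveMeasureFamily (α := fun _ => X) (fun I : Finset ℕ => μ.map I.restrict) := by
    intro I J hJI
    rw [Measure.map_map (by fun_prop) (by fun_prop)]
    rfl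
  rw [isProjectiveLimit_nat_iff hp]
  intro n
  refine Measure.ext_of_singleton fun y => ?_
  obtain ⟨x, rfl⟩ : ∃ x : ℕ → X, Preorder.frestrictLe n x = y :=
    ⟨fun t => y ⟨min t n, by simp⟩, by
      ext t
      have := Finset.mem_Iic.1 t.2
      simp [Preorder.frestrictLe, this]⟩
  have hs : Preorder.frestrictLe (π := fun _ => X) n ⁻¹' {Preorder.frestrictLe n x} =
      {ω | ∀ t < n + 1, ω t = x t} := by
    ext ω
    simp only [Set.mem_preimage, Set.mem_singleton_iff, funext_iff, Set.mem_ofPred_eq]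
    constructor
    · intro H t ht
      exact H ⟨t, by simp; omega⟩
    · intro H t
      exact H t (by have := Finset.mem_Iic.1 t.2; omega)
  have := h n x
  rw [← hs] at this
  rw [Measure.map_apply (by fun_prop) (measurableSet_singleton _)]
  change _ = (Measure.map (Preorder.frestrictLe n) μ) _
  rw [Measure.map_apply (by fun_prop) (measurableSet_singleton _)]
  exact this.symm

/-- The Markov property at the first step. -/
lemma chainLaw_eq_cons (init : PMF X) (step : ℕ → X → PMF X) :
    chainLaw init step = ∑ x : X, init x •
      (chainLaw (step 0 x) fun n => step (n + 1)).map (pathCons x) := by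
  classical
  have : IsFiniteMeasure (∑ x : X, init x •
      (chainLaw (step 0 x) fun n => step (n + 1)).map (pathCons x)) := by
    constructor
    rw [Measure.finsetSum_apply]
    refine ENNReal.sum_lt_top.2 fun x _ => ?_
    rw [Measure.smul_apply, smul_eq_mul]
    exact ENNReal.mul_lt_top (init.apply_lt_top x) (by
      rw [Measure.map_apply (measurable_pathCons x) .univ]; exact measure_lt_top _ _)
  refine measure_path_ext fun n x => ?_
  rw [chainLaw_cyl, Measure.finsetSum_apply, Finset.sum_eq_single (x 0)]
  · rw [Measure.smul_apply, smul_eq_mul, Measure.map_apply (measurable_pathCons _)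
      (measurableSet_cyl _ _)]
    congr 1
    cases n with
    | zero =>
      rw [show pathCons (x 0) ⁻¹' {ω | ∀ t < 0 + 1, ω t = x t} = Set.univ by ext; simp]
      simp
    | succ n =>
      rw [show pathCons (x 0) ⁻¹' {ω | ∀ t < n + 1 + 1, ω t = x t} =
        {ω | ∀ t < n + 1, ω t = (fun t => x (t + 1)) t} by
          ext ω
          simp only [Set.mem_preimage, Set.mem_ofPred_eq]
          constructor
          · intro H t ht
            exact H (t + 1) (by omega)
          · rintro H (_ | t) ht
            · rfl
            · exact H t (by omega), chainLaw_cyl, Finset.prod_range_succ']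
      ring
  · intro b _ hb
    rw [Measure.smul_apply, smul_eq_mul, Measure.map_apply (measurable_pathCons _)
      (measurableSet_cyl _ _)]
    rw [show pathCons b ⁻¹' {ω | ∀ t < n + 1, ω t = x t} = ∅ by
      ext ω
      simp only [Set.mem_preimage, Set.mem_ofPred_eq, Set.mem_empty_iff_false, iff_false]
      intro H
      exact hb (H 0 (by omega))]
    simp
  · simp

lemma chainLaw_apply_cons (init : PMF X) (step : ℕ → X → PMF X) {E : Set (ℕ → X)}
    (hE : MeasurableSet E) :
    chainLaw init step E = ∑ x : X, init x *
      chainLaw (step 0 x) (fun n => step (n + 1)) (pathCons x ⁻¹' E) := by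
  conv_lhs => rw [chainLaw_eq_cons]
  rw [Measure.finsetSum_apply]
  refine Finset.sum_congr rfl fun x _ => ?_
  rw [Measure.smul_apply, smul_eq_mul, Measure.map_apply (measurable_pathCons _) hE]

lemma chainLaw_real_cons (init : PMF X) (step : ℕ → X → PMF X) {E : Set (ℕ → X)}
    (hE : MeasurableSet E) :
    (chainLaw init step).real E = ∑ x : X, (init x).toReal *
      (chainLaw (step 0 x) fun n => step (n + 1)).real (pathCons x ⁻¹' E) := by
  rw [Measure.real, chainLaw_apply_cons _ _ hE, ENNReal.toReal_sum]
  · simp [Measure.real, ENNReal.toReal_mul]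
  · intro x _
    exact ENNReal.mul_ne_top (init.apply_ne_top x) (measure_ne_top _ _)

/-- The law of a chain is affine in its initial distribution. -/
lemma chainLaw_bind {Y : Type*} [Fintype Y] (p : PMF Y) (f : Y → PMF X) (step : ℕ → X → PMF X)
    (E : Set (ℕ → X)) :
    chainLaw (p.bind f) step E = ∑ y, p y * chainLaw (f y) step E := by
  simp only [chainLaw_eq_sum_traj, Measure.finsetSum_apply, Measure.smul_apply, smul_eq_mul,
    PMF.bind_apply, tsum_fintype, Finset.sum_mul, Finset.mul_sum]
  rw [Finset.sum_comm]
  simp only [mul_assoc]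

end Chain

/-! ### Entropy, divergence and total correlation -/

section Information

/-- The image of the weights `P` under `f`: the marginal distribution of `f`. -/
noncomputable def marg {Z Y : Type*} [Fintype Z] (P : Z → ℝ) (f : Z → Y) (y : Y) : ℝ :=
  open Classical in ∑ z, if f z = y then P z else 0

/-- The Shannon entropy of the weights `P`. -/
noncomputable def ent {Z : Type*} [Fintype Z] (P : Z → ℝ) : ℝ := ∑ z, Real.negMulLog (P z)

/-- The Kullback-Leibler divergence of the weights `P` from the weights `Q`; it has its usual
meaning when `Q z = 0` implies `P z = 0`. -/
noncomputable def kl {Z : Type*} [Fintype Z] (P Q : Z → ℝ) : ℝ :=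
  ∑ z, P z * (Real.log (P z) - Real.log (Q z))

/-- The total correlation of the variables `p i` under the weights `P`. -/
noncomputable def tc {ι Z : Type*} [Fintype ι] [Fintype Z] {Y : ι → Type*} [∀ i, Fintype (Y i)]
    (P : Z → ℝ) (p : ∀ i, Z → Y i) : ℝ :=
  ∑ i, ent (marg P (p i)) - ent P

/-- The weight of `z` under the product of the marginal distributions of the variables `p i`. -/
noncomputable def prodMarg {ι Z : Type*} [Fintype ι] [Fintype Z] {Y : ι → Type*}
    (P : Z → ℝ) (p : ∀ i, Z → Y i) (z : Z) : ℝ :=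
  ∏ i, marg P (p i) (p i z)

lemma marg_nonneg {Z Y : Type*} [Fintype Z] {P : Z → ℝ} (hP : ∀ z, 0 ≤ P z) (f : Z → Y) (y : Y) :
    0 ≤ marg P f y := by
  classical
  exact Finset.sum_nonneg fun z _ => by split_ifs <;> simp [hP]

lemma le_marg {Z Y : Type*} [Fintype Z] {P : Z → ℝ} (hP : ∀ z, 0 ≤ P z) (f : Z → Y) (z : Z) :
    P z ≤ marg P f (f z) := by
  classical
  unfold marg
  refine le_trans (by simp) (Finset.single_le_sum
    (f := fun z' => if f z' = f z then P z' else 0) (fun z' _ => ?_) (Finset.mem_univ z))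
  split_ifs <;> simp [hP]

lemma sum_marg_mul {Z Y : Type*} [Fintype Z] [Fintype Y] (P : Z → ℝ) (f : Z → Y) (g : Y → ℝ) :
    ∑ y, marg P f y * g y = ∑ z, P z * g (f z) := by
  classical
  unfold marg
  simp_rw [Finset.sum_mul]
  rw [Finset.sum_comm]
  refine Finset.sum_congr rfl fun z _ => ?_
  simp

lemma sum_marg {Z Y : Type*} [Fintype Z] [Fintype Y] (P : Z → ℝ) (f : Z → Y) :
    ∑ y, marg P f y = ∑ z, P z := by
  simpa using sum_marg_mul P f fun _ => 1

lemma ent_marg {Z Y : Type*} [Fintype Z] [Fintype Y] (P : Z → ℝ) (f : Z → Y) :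
    ent (marg P f) = -∑ z, P z * Real.log (marg P f (f z)) := by
  unfold ent
  rw [← sum_marg_mul P f fun y => Real.log (marg P f y), ← Finset.sum_neg_distrib]
  simp [Real.negMulLog]

/-- The total correlation is the divergence from the product of the marginal distributions. -/
lemma kl_prodMarg {ι Z : Type*} [Fintype ι] [Fintype Z] {Y : ι → Type*} [∀ i, Fintype (Y i)]
    {P : Z → ℝ} (hP : ∀ z, 0 ≤ P z) (p : ∀ i, Z → Y i) :
    kl P (prodMarg P p) = tc P p := by
  unfold kl tc
  simp_rw [ent_marg]
  rw [Finset.sum_neg_distrib, Finset.sum_comm, ent, ← Finset.sum_neg_distrib,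
    ← Finset.sum_sub_distrib]
  refine Finset.sum_congr rfl fun z _ => ?_
  rcases eq_or_ne (P z) 0 with h | h
  · simp [h]
  · have hpos : 0 < P z := lt_of_le_of_ne (hP z) h.symm
    rw [prodMarg, Real.log_prod fun i _ => (hpos.trans_le (le_marg hP (p i) z)).ne',
      ← Finset.mul_sum, Real.negMulLog]
    ring

lemma prodMarg_nonneg {ι Z : Type*} [Fintype ι] [Fintype Z] {Y : ι → Type*}
    {P : Z → ℝ} (hP : ∀ z, 0 ≤ P z) (p : ∀ i, Z → Y i) (z : Z) : 0 ≤ prodMarg P p z :=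
  Finset.prod_nonneg fun _ _ => marg_nonneg hP _ _

lemma prodMarg_ne_zero {ι Z : Type*} [Fintype ι] [Fintype Z] {Y : ι → Type*}
    {P : Z → ℝ} (hP : ∀ z, 0 ≤ P z) (p : ∀ i, Z → Y i) {z : Z} (hz : P z ≠ 0) :
    prodMarg P p z ≠ 0 :=
  Finset.prod_ne_zero_iff.2 fun i _ =>
    ((lt_of_le_of_ne (hP z) hz.symm).trans_le (le_marg hP (p i) z)).ne'

lemma sum_prodMarg_le_one {ι Z : Type*} [Fintype ι] [Fintype Z] {Y : ι → Type*}
    [∀ i, Fintype (Y i)] {P : Z → ℝ} (hP : ∀ z, 0 ≤ P z) (hP1 : ∑ z, P z = 1) (p : ∀ i, Z → Y i)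
    (hp : Function.Injective fun z i => p i z) : ∑ z, prodMarg P p z ≤ 1 := by
  classical
  calc ∑ z, prodMarg P p z
      = ∑ y ∈ Finset.univ.map ⟨fun z i => p i z, hp⟩, ∏ i, marg P (p i) (y i) := by
        rw [Finset.sum_map]; rfl
    _ ≤ ∑ y : ∀ i, Y i, ∏ i, marg P (p i) (y i) :=
        Finset.sum_le_sum_of_subset_of_nonneg (Finset.subset_univ _) fun _ _ _ =>
          Finset.prod_nonneg fun _ _ => marg_nonneg hP _ _
    _ = 1 := by
        rw [← Fintype.prod_sum]
        simp [sum_marg, hP1]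

/-- Gibbs' inequality. -/
lemma kl_nonneg {Z : Type*} [Fintype Z] {P R : Z → ℝ} (hP : ∀ z, 0 ≤ P z) (hP1 : ∑ z, P z = 1)
    (hR : ∀ z, 0 ≤ R z) (hR1 : ∑ z, R z ≤ 1) (hPR : ∀ z, P z ≠ 0 → R z ≠ 0) : 0 ≤ kl P R := by
  have h : ∀ z, P z - R z ≤ P z * (Real.log (P z) - Real.log (R z)) := by
    intro z
    rcases eq_or_ne (P z) 0 with h | h
    · simp [h, hR z]
    · have hpos : 0 < P z := lt_of_le_of_ne (hP z) h.symm
      have hpos' : 0 < R z := lt_of_le_of_ne (hR z) (hPR z h).symm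
      have h1 := Real.log_le_sub_one_of_pos (div_pos hpos' hpos)
      rw [Real.log_div hpos'.ne' h] at h1
      have h2 := mul_le_mul_of_nonneg_left h1 hpos.le
      have h3 : P z * (R z / P z - 1) = R z - P z := by field_simp
      linarith
  have := Finset.sum_le_sum fun z (_ : z ∈ Finset.univ) => h z
  rw [Finset.sum_sub_distrib, hP1] at this
  unfold kl
  linarith

lemma tc_nonneg {ι Z : Type*} [Fintype ι] [Fintype Z] {Y : ι → Type*}
    [∀ i, Fintype (Y i)] {P : Z → ℝ} (hP : ∀ z, 0 ≤ P z) (hP1 : ∑ z, P z = 1) (p : ∀ i, Z → Y i)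
    (hp : Function.Injective fun z i => p i z) : 0 ≤ tc P p := by
  rw [← kl_prodMarg hP]
  exact kl_nonneg hP hP1 (prodMarg_nonneg hP p) (sum_prodMarg_le_one hP hP1 p hp)
    fun z => prodMarg_ne_zero hP p

/-- Jensen's inequality for `x ↦ -x log x`, with unnormalized weights. -/
lemma sum_mul_negMulLog_le {X : Type*} [Fintype X] {w h : X → ℝ} (hw : ∀ x, 0 ≤ w x)
    (hh : ∀ x, 0 ≤ h x) :
    ∑ x, w x * Real.negMulLog (h x) ≤
      Real.negMulLog (∑ x, w x * h x) + (∑ x, w x * h x) * Real.log (∑ x, w x) := by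
  rcases (Finset.sum_nonneg fun x (_ : x ∈ Finset.univ) => hw x).eq_or_lt with hm | hm
  · have h0 : ∀ x, w x = 0 := fun x =>
      (Finset.sum_eq_zero_iff_of_nonneg fun x _ => hw x).1 hm.symm x (Finset.mem_univ x)
    simp [h0]
  · set m := ∑ x, w x with hm_def
    have hJ := Real.concaveOn_negMulLog.le_map_sum (t := Finset.univ) (w := fun x => w x / m)
      (p := h) (fun x _ => div_nonneg (hw x) hm.le)
      (by rw [← Finset.sum_div, ← hm_def, div_self hm.ne']) (fun x _ => hh x)
    simp only [smul_eq_mul, div_mul_eq_mul_div, ← Finset.sum_div] at hJ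
    set s := ∑ x, w x * h x
    rw [div_le_iff₀ hm] at hJ
    refine hJ.trans (le_of_eq ?_)
    rcases eq_or_ne s 0 with hs | hs
    · simp [hs]
    · rw [Real.negMulLog, Real.negMulLog, Real.log_div hs hm.ne']
      field_simp
      ring

/-- Conditioning on more reduces entropy: if `x` has weights `ν` and `u` has conditional weights
`H x`, then `H(q x, u) ≥ H(q x) + H(u | x)`. -/
lemma ent_cond_le {X A U : Type*} [Fintype X] [Fintype A] [Fintype U] {ν : X → ℝ}
    (hν : ∀ x, 0 ≤ ν x) (q : X → A) {H : X → U → ℝ} (hH : ∀ x u, 0 ≤ H x u)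
    (hH1 : ∀ x, ∑ u, H x u = 1) :
    ent (marg ν q) + ∑ x, ν x * ent (H x) ≤
      ∑ a, ∑ u, Real.negMulLog (marg (fun x => ν x * H x u) q a) := by
  classical
  -- group the states `x` by the value of `q`
  have hsplit : ∑ x, ν x * ent (H x) =
      ∑ a, ∑ x, (if q x = a then ν x else 0) * ent (H x) := by
    rw [Finset.sum_comm]
    refine Finset.sum_congr rfl fun x _ => ?_
    simp
  rw [hsplit, ent, ← Finset.sum_add_distrib]
  refine Finset.sum_le_sum fun a _ => ?_
  have hJ : ∀ u, ∑ x, (if q x = a then ν x else 0) * H x u = marg (fun x => ν x * H x u) q a :=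
    fun u => Finset.sum_congr rfl fun x _ => by split_ifs <;> simp
  have key : ∀ u, ∑ x, (if q x = a then ν x else 0) * Real.negMulLog (H x u) ≤
      Real.negMulLog (marg (fun x => ν x * H x u) q a) +
        marg (fun x => ν x * H x u) q a * Real.log (marg ν q a) := by
    intro u
    have := sum_mul_negMulLog_le (w := fun x => if q x = a then ν x else 0) (h := fun x => H x u)
      (fun x => by split_ifs <;> simp [hν]) (fun x => hH x u)
    rw [hJ] at this
    exact this
  have hsum : ∑ u, marg (fun x => ν x * H x u) q a = marg ν q a := by
    simp_rw [← hJ]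
    rw [Finset.sum_comm]
    simp_rw [← Finset.mul_sum, hH1, mul_one]
    rfl
  have := Finset.sum_le_sum fun u (_ : u ∈ Finset.univ) => key u
  rw [Finset.sum_add_distrib, ← Finset.sum_mul, hsum, Finset.sum_comm] at this
  simp_rw [← Finset.mul_sum] at this
  rw [Real.negMulLog]
  unfold ent
  linarith

/-- The chain rule for entropy. -/
lemma ent_joint {X Z : Type*} [Fintype X] [Fintype Z] {ν : X → ℝ} {F : X → Z → ℝ}
    (hF1 : ∀ x, ∑ z, F x z = 1) :
    ∑ x, ∑ z, Real.negMulLog (ν x * F x z) = ent ν + ∑ x, ν x * ent (F x) := by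
  unfold ent
  rw [← Finset.sum_add_distrib]
  refine Finset.sum_congr rfl fun x _ => ?_
  simp_rw [Real.negMulLog_mul]
  rw [Finset.sum_add_distrib, ← Finset.sum_mul, hF1, one_mul, Finset.mul_sum]

/-- The chain rule for the divergence, for two joint distributions with the same first marginal. -/
lemma kl_joint {X Z W : Type*} [Fintype X] [Fintype Z] [Fintype W] (e : X × Z ≃ W)
    {ν : X → ℝ} {F K : X → Z → ℝ} (hFK : ∀ x z, ν x ≠ 0 → F x z ≠ 0 → K x z ≠ 0) {P Q : W → ℝ}
    (hP : ∀ x z, P (e (x, z)) = ν x * F x z) (hQ : ∀ x z, Q (e (x, z)) = ν x * K x z) :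
    kl P Q = ∑ x, ν x * kl (F x) (K x) := by
  unfold kl
  rw [← e.sum_comp, Fintype.sum_prod_type]
  refine Finset.sum_congr rfl fun x _ => ?_
  rw [Finset.mul_sum]
  refine Finset.sum_congr rfl fun z _ => ?_
  rw [hP, hQ]
  rcases eq_or_ne (ν x) 0 with h | h
  · simp [h]
  rcases eq_or_ne (F x z) 0 with h' | h'
  · simp [h']
  rw [Real.log_mul h h', Real.log_mul h (hFK x z h h')]
  ring

/-- The mean total correlation of the second component of a pair, conditionally on the first, is
at most the total correlation of the pair. -/
lemma sum_mul_tc_le {ι X Z W : Type*} [Fintype ι] [Fintype X] [Fintype Z] [Fintype W]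
    {A U V : ι → Type*} [∀ i, Fintype (A i)] [∀ i, Fintype (U i)] [∀ i, Fintype (V i)]
    (e : X × Z ≃ W) (e' : ∀ i, A i × U i ≃ V i) {q : ∀ i, X → A i} {p : ∀ i, Z → U i}
    {r : ∀ i, W → V i} (hr : ∀ i x z, r i (e (x, z)) = e' i (q i x, p i z))
    (hq : Function.Injective fun x i => q i x)
    {ν : X → ℝ} (hν : ∀ x, 0 ≤ ν x) (hν1 : ∑ x, ν x = 1)
    {F : X → Z → ℝ} (hF : ∀ x z, 0 ≤ F x z) (hF1 : ∀ x, ∑ z, F x z = 1) {P : W → ℝ}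
    (hP : ∀ x z, P (e (x, z)) = ν x * F x z) :
    ∑ x, ν x * tc (F x) p ≤ tc P r := by
  classical
  have h1 : ent P = ent ν + ∑ x, ν x * ent (F x) := by
    rw [← ent_joint hF1, ent, ← e.sum_comp, Fintype.sum_prod_type]
    simp_rw [hP]
  have h2 : ∀ i, ent (marg ν (q i)) + ∑ x, ν x * ent (marg (F x) (p i)) ≤ ent (marg P (r i)) := by
    intro i
    refine (ent_cond_le hν (q i) (H := fun x => marg (F x) (p i))
      (fun x u => marg_nonneg (hF x) _ _) (fun x => by rw [sum_marg, hF1])).trans (le_of_eq ?_)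
    rw [ent, ← (e' i).sum_comp, Fintype.sum_prod_type]
    refine Finset.sum_congr rfl fun a _ => Finset.sum_congr rfl fun u _ => ?_
    congr 1
    rw [marg, marg, ← e.sum_comp, Fintype.sum_prod_type]
    refine Finset.sum_congr rfl fun x _ => ?_
    simp_rw [hr, hP, (e' i).apply_eq_iff_eq, Prod.mk.injEq, marg]
    by_cases hx : q i x = a
    · simp [hx, Finset.mul_sum]
    · simp [hx]
  have h3 := tc_nonneg hν hν1 q hq
  have h4 := Finset.sum_le_sum fun i (_ : i ∈ Finset.univ) => h2 i
  rw [Finset.sum_add_distrib, Finset.sum_comm] at h4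
  unfold tc at h3 ⊢
  simp_rw [mul_sub, Finset.mul_sum]
  rw [Finset.sum_sub_distrib]
  linarith

/-- The Bhattacharyya coefficient is at least `exp (-kl / 2)`. -/
lemma exp_neg_kl_le {Z : Type*} [Fintype Z] {P Q : Z → ℝ} (hP : ∀ z, 0 ≤ P z)
    (hP1 : ∑ z, P z = 1) (hQ : ∀ z, 0 ≤ Q z) (hPQ : ∀ z, P z ≠ 0 → Q z ≠ 0) :
    Real.exp (-(kl P Q) / 2) ≤ ∑ z, Real.sqrt (P z * Q z) := by
  set m := -(kl P Q) / 2 with hm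
  -- the tangent line of the exponential function at `m`, evaluated at `log (Q z / P z) / 2`
  have h : ∀ z, P z * (Real.exp m * (1 + ((Real.log (Q z) - Real.log (P z)) / 2 - m))) ≤
      Real.sqrt (P z * Q z) := by
    intro z
    rcases eq_or_ne (P z) 0 with h | h
    · simp [h]
    · have hpos : 0 < P z := lt_of_le_of_ne (hP z) h.symm
      have hpos' : 0 < Q z := lt_of_le_of_ne (hQ z) (hPQ z h).symm
      have h1 : Real.sqrt (P z * Q z) =
          P z * Real.exp ((Real.log (Q z) - Real.log (P z)) / 2) := by
        rw [Real.exp_half, Real.exp_sub, Real.exp_log hpos, Real.exp_log hpos']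
        refine (Real.sqrt_eq_iff_mul_self_eq (by positivity) (by positivity)).2 ?_
        rw [mul_mul_mul_comm, Real.mul_self_sqrt (by positivity)]
        field_simp
      rw [h1]
      refine mul_le_mul_of_nonneg_left ?_ hpos.le
      have h2 := Real.add_one_le_exp ((Real.log (Q z) - Real.log (P z)) / 2 - m)
      have h3 := mul_le_mul_of_nonneg_left h2 (Real.exp_pos m).le
      rwa [← Real.exp_add, add_sub_cancel, add_comm _ (1 : ℝ)] at h3
  refine le_trans (le_of_eq ?_) (Finset.sum_le_sum fun z _ => h z)
  have h5 : ∑ z, P z * (Real.exp m * (1 + ((Real.log (Q z) - Real.log (P z)) / 2 - m))) =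
      Real.exp m * ((1 - m) * ∑ z, P z - kl P Q / 2) := by
    rw [kl, Finset.mul_sum, Finset.sum_div, ← Finset.sum_sub_distrib, Finset.mul_sum]
    exact Finset.sum_congr rfl fun z _ => by ring
  rw [h5, hP1, hm]
  ring

/-- The Bretagnolle-Huber inequality. -/
lemma sub_le_sqrt_one_sub_exp_neg_kl {Z : Type*} [Fintype Z] {P Q : Z → ℝ} (hP : ∀ z, 0 ≤ P z)
    (hP1 : ∑ z, P z = 1) (hQ : ∀ z, 0 ≤ Q z) (hQ1 : ∑ z, Q z = 1)
    (hPQ : ∀ z, P z ≠ 0 → Q z ≠ 0) (E : Finset Z) :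
    ∑ z ∈ E, P z - ∑ z ∈ E, Q z ≤ Real.sqrt (1 - Real.exp (-(kl P Q))) := by
  classical
  -- Cauchy-Schwarz bounds the coefficient on `E` and on its complement
  have hCS : ∀ s : Finset Z, ∑ z ∈ s, Real.sqrt (P z * Q z) ≤
      Real.sqrt (∑ z ∈ s, P z) * Real.sqrt (∑ z ∈ s, Q z) := by
    intro s
    simp_rw [Real.sqrt_mul (hP _)]
    exact Real.sum_sqrt_mul_sqrt_le s (fun z => hP z) fun z => hQ z
  have hB := exp_neg_kl_le hP hP1 hQ hPQ
  rw [← Finset.sum_add_sum_compl E] at hB hP1 hQ1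
  have h1 := hCS E
  have h2 := hCS Eᶜ
  set a := ∑ z ∈ E, P z
  set b := ∑ z ∈ E, Q z
  have ha0 : 0 ≤ a := Finset.sum_nonneg fun z _ => hP z
  have hb0 : 0 ≤ b := Finset.sum_nonneg fun z _ => hQ z
  have ha1 : 0 ≤ ∑ z ∈ Eᶜ, P z := Finset.sum_nonneg fun z _ => hP z
  have hb1 : 0 ≤ ∑ z ∈ Eᶜ, Q z := Finset.sum_nonneg fun z _ => hQ z
  rw [← eq_sub_iff_add_eq'] at hP1 hQ1
  rw [hP1] at h2 ha1
  rw [hQ1] at h2 hb1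
  refine Real.le_sqrt_of_sq_le ?_
  have h3 : Real.exp (-(kl P Q)) ≤
      (Real.sqrt a * Real.sqrt b + Real.sqrt (1 - a) * Real.sqrt (1 - b)) ^ 2 := by
    have : Real.exp (-(kl P Q)) = Real.exp (-(kl P Q) / 2) ^ 2 := by
      rw [← Real.exp_nat_mul]; congr 1; push_cast; ring
    rw [this]
    exact pow_le_pow_left₀ (Real.exp_pos _).le (by linarith) 2
  have e1 := Real.sq_sqrt ha0
  have e2 := Real.sq_sqrt hb0
  have e3 := Real.sq_sqrt ha1
  have e4 := Real.sq_sqrt hb1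
  have h4 := two_mul_le_add_sq (Real.sqrt a * Real.sqrt (1 - a)) (Real.sqrt b * Real.sqrt (1 - b))
  simp only [mul_pow, e1, e2, e3, e4] at h4
  have h5 : (Real.sqrt a * Real.sqrt b + Real.sqrt (1 - a) * Real.sqrt (1 - b)) ^ 2 =
      a * b + (1 - a) * (1 - b) +
        2 * (Real.sqrt a * Real.sqrt (1 - a)) * (Real.sqrt b * Real.sqrt (1 - b)) := by
    rw [add_sq, mul_pow, mul_pow, e1, e2, e3, e4]; ring
  nlinarith

end Information

/-! ### Path prefixes -/

section Prefix

/-- The first `T` entries of a path. -/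
def pathPrefix {X : Type*} (T : ℕ) (ω : ℕ → X) : Fin T → X := fun t => ω t

lemma measurable_pathPrefix {X : Type*} [MeasurableSpace X] (T : ℕ) :
    Measurable (pathPrefix (X := X) T) :=
  measurable_pi_lambda _ fun t => measurable_pi_apply (t : ℕ)

/-- The probability that the first `T` entries of a path with law `μ` are `z`. -/
def prefixProb {X : Type*} [MeasurableSpace X] (μ : Measure (ℕ → X)) (T : ℕ) (z : Fin T → X) : ℝ :=
  μ.real (pathPrefix T ⁻¹' {z})

variable {X : Type*} [Fintype X] [MeasurableSpace X] [MeasurableSingletonClass X]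

lemma prefixProb_nonneg {X : Type*} [MeasurableSpace X] (μ : Measure (ℕ → X)) (T : ℕ)
    (z : Fin T → X) : 0 ≤ prefixProb μ T z := measureReal_nonneg

lemma sum_prefixProb_eq_real {X : Type*} [MeasurableSpace X] [MeasurableSingletonClass X]
    (μ : Measure (ℕ → X)) [IsProbabilityMeasure μ] (T : ℕ)
    (E : Finset (Fin T → X)) :
    ∑ z ∈ E, prefixProb μ T z = μ.real (pathPrefix T ⁻¹' (E : Set (Fin T → X))) :=
  sum_measureReal_preimage_singleton E fun z _ =>
    measurable_pathPrefix T (measurableSet_singleton z)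

lemma sum_prefixProb (μ : Measure (ℕ → X)) [IsProbabilityMeasure μ] (T : ℕ) :
    ∑ z, prefixProb μ T z = 1 := by
  classical
  rw [sum_prefixProb_eq_real]
  simp

lemma marg_prefixProb (μ : Measure (ℕ → X)) [IsProbabilityMeasure μ] (T : ℕ)
    {Y : Type*} (f : (Fin T → X) → Y) (y : Y) :
    marg (prefixProb μ T) f y = μ.real ((fun ω => f (pathPrefix T ω)) ⁻¹' {y}) := by
  classical
  unfold marg
  rw [← Finset.sum_filter, sum_prefixProb_eq_real]
  congr 1
  ext ω
  simp

lemma pathPrefix_succ_pathCons {X : Type*} (T : ℕ) (x : X) (ω : ℕ → X) :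
    pathPrefix (T + 1) (pathCons x ω) = Fin.cons x (pathPrefix T ω) := by
  ext t
  refine Fin.cases ?_ (fun t => ?_) t
  · rfl
  · simp [pathPrefix]

/-- If `μ` first draws `x` from `ν` and then a path from `μ' x`, its prefix probabilities factor
accordingly. -/
lemma prefixProb_cons {μ : Measure (ℕ → X)} {ν : PMF X} {μ' : X → Measure (ℕ → X)}
    [∀ x, IsProbabilityMeasure (μ' x)]
    (h : ∀ E, MeasurableSet E → μ E = ∑ x, ν x * μ' x (pathCons x ⁻¹' E)) (T : ℕ)
    (x : X) (z : Fin T → X) :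
    prefixProb μ (T + 1) (Fin.cons x z) = (ν x).toReal * prefixProb (μ' x) T z := by
  classical
  rw [prefixProb, Measure.real, h _ (measurable_pathPrefix _ (measurableSet_singleton _)),
    Finset.sum_eq_single x]
  · rw [ENNReal.toReal_mul]
    congr 3
    ext ω
    simp [pathPrefix_succ_pathCons, Fin.cons_inj]
  · intro b _ hb
    rw [show pathCons b ⁻¹' (pathPrefix (T + 1) ⁻¹' {Fin.cons x z}) = ∅ by
      ext ω
      simp [pathPrefix_succ_pathCons, Fin.cons_inj, hb]]
    simp
  · simp

lemma measurableSet_obs {Y : Type*} (T : ℕ) (o : X → Y) (y : Fin T → Y) :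
    MeasurableSet {ω : ℕ → X | ∀ t : Fin T, o (ω t) = y t} := by
  rw [Set.ofPred_forall]
  refine MeasurableSet.iInter fun t => ?_
  exact (Set.toFinite {x | o x = y t}).measurableSet.preimage (measurable_pi_apply (t : ℕ))

lemma chainLaw_real_obs_succ {Y : Type*} [DecidableEq Y] (ν : PMF X) (step : ℕ → X → PMF X) (T : ℕ)
    (o : X → Y) (y : Fin (T + 1) → Y) :
    (chainLaw ν step).real {ω | ∀ t : Fin (T + 1), o (ω t) = y t} =
      ∑ x, if o x = y 0 then (ν x).toReal * (chainLaw (step 0 x) fun n => step (n + 1)).real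
        {ω | ∀ t : Fin T, o (ω t) = y t.succ} else 0 := by
  rw [chainLaw_real_cons _ _ (measurableSet_obs _ _ _)]
  refine Finset.sum_congr rfl fun x _ => ?_
  have h : pathCons x ⁻¹' {ω | ∀ t : Fin (T + 1), o (ω t) = y t} =
      {ω | o x = y 0 ∧ ∀ t : Fin T, o (ω t) = y t.succ} := by
    ext ω
    simp [Fin.forall_fin_succ]
  rw [h]
  split_ifs with hx <;> simp [hx]

/-- Chains that are started independently and move independently are independent. -/
lemma chainLaw_pmfPi_real_obs {ι : Type*} [Fintype ι] [DecidableEq ι] {Y : ι → Type*}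
    (o : ∀ i, X → Y i) (K : X → PMF X) (T : ℕ) (ν : ι → PMF X) (y : ∀ i, Fin T → Y i) :
    (chainLaw (pmfPi ν) fun _ (r : ι → X) => pmfPi fun i => K (r i)).real
        {ω | ∀ t : Fin T, (fun i => o i (ω t i)) = fun i => y i t} =
      ∏ i, (chainLaw (ν i) fun _ => K).real {ω | ∀ t : Fin T, o i (ω t) = y i t} := by
  classical
  induction T generalizing ν with
  | zero => simp
  | succ T ih =>
    rw [chainLaw_real_obs_succ _ _ _ (fun r : ι → X => fun i => o i (r i)) fun t i => y i t]
    simp_rw [chainLaw_real_obs_succ]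
    rw [Fintype.prod_sum]
    refine Finset.sum_congr rfl fun r _ => ?_
    rw [Finset.prod_ite_zero]
    simp only [funext_iff, Finset.mem_univ, true_implies]
    congr 1
    rw [Finset.prod_mul_distrib]
    congr 1
    · simp [pmfPi, PMF.ofFintype_apply, ENNReal.toReal_prod]
    · have := ih (fun i => K (r i)) fun i t => y i t.succ
      simp only [funext_iff] at this
      exact this

end Prefix

/-! ### Imaginary play with the communication lost at a fixed time -/

section Game

/-- Agent `i`'s part of a joint path of length `T`. -/
def agentPath {N : ℕ} {S : Fin N → Type*} {A : Fin N → Type*} (T : ℕ)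
    (i : Fin N) (z : Fin T → StateAction S A) : Fin T → S i × A i :=
  fun t => ((z t).1 i, (z t).2 i)

lemma agent_injective {N : ℕ} {S : Fin N → Type*} {A : Fin N → Type*} :
    Function.Injective fun (x : StateAction S A) i => (x.1 i, x.2 i) := by
  intro x y h
  simp only [funext_iff, Prod.mk.injEq] at h
  exact Prod.ext (funext fun i => (h i).1) (funext fun i => (h i).2)

lemma agentPath_injective {N : ℕ} {S : Fin N → Type*} {A : Fin N → Type*} (T : ℕ) :
    Function.Injective fun (z : Fin T → StateAction S A) i => agentPath T i z := by
  intro z w h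
  funext t
  exact agent_injective (funext fun i => congrFun (congrFun h i) t)

variable {N : ℕ} {S : Fin N → Type*} {A : Fin N → Type*}
  [∀ i, Fintype (S i)] [∀ i, MeasurableSpace (S i)] [∀ i, MeasurableSingletonClass (S i)]
  [∀ i, Fintype (A i)] [∀ i, MeasurableSpace (A i)] [∀ i, MeasurableSingletonClass (A i)]
  (G : ∀ i, MDP (S i) (A i)) (π : (∀ i, S i) → PMF (∀ i, A i))

/-- The law of the joint path with full communication when the first joint state-action pair has
distribution `ν`. -/
noncomputable def pathLaw (ν : PMF (StateAction S A)) : Measure (ℕ → StateAction S A) :=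
  chainLaw ν fun _ => jointStep G π

instance (ν : PMF (StateAction S A)) : IsProbabilityMeasure (pathLaw G π ν) :=
  isProbabilityMeasure_chainLaw _ _

instance (s : ∀ i, S i) : IsProbabilityMeasure (fullLawFrom G π s) :=
  isProbabilityMeasure_chainLaw _ _

instance : IsProbabilityMeasure (fullLaw G π) :=
  isProbabilityMeasure_chainLaw _ _

open Classical in
/-- The law of the agents' records under imaginary play with communication at the times `t < k`,
when the first joint state-action pair, or every agent's version of it, has distribution `ν`. -/
noncomputable def recordLaw (ν : PMF (StateAction S A)) (k : ℕ∞) : Measure (ℕ → Record S A) :=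
  chainLaw (if (0 : ℕ∞) < k then ν.map fun x _ => x else pmfPi fun _ => ν)
    fun n => imgStep G π (((n + 1 : ℕ) : ℕ∞) < k)

/-- The law of the true joint path when the records have law `recordLaw`. -/
noncomputable def imgPathLaw (ν : PMF (StateAction S A)) (k : ℕ∞) : Measure (ℕ → StateAction S A) :=
  (recordLaw G π ν k).map fun ω t => actual (ω t)

lemma measurable_actual_path :
    Measurable fun (ω : ℕ → Record S A) (t : ℕ) => actual (ω t) :=
  measurable_pi_lambda _ fun t =>
    (measurable_of_countable (actual (S := S) (A := A))).comp (measurable_pi_apply t)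

instance (ν : PMF (StateAction S A)) (k : ℕ∞) : IsProbabilityMeasure (imgPathLaw G π ν k) := by
  unfold imgPathLaw recordLaw
  exact Measure.isProbabilityMeasure_map measurable_actual_path.aemeasurable

lemma fullLaw_eq_pathLaw : fullLaw G π = pathLaw G π (drawAction π (jointInit G)) := rfl

lemma imgLawAt_eq_imgPathLaw (k : ℕ∞) :
    imgLawAt G π k = imgPathLaw G π (drawAction π (jointInit G)) k := by
  unfold imgLawAt imgPathLaw recordLaw imgInit
  congr

/-- The Markov property at the first step, with full communication. -/
lemma pathLaw_cons (ν : PMF (StateAction S A)) (E : Set (ℕ → StateAction S A))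
    (hE : MeasurableSet E) :
    pathLaw G π ν E = ∑ x, ν x * pathLaw G π (jointStep G π x) (pathCons x ⁻¹' E) :=
  chainLaw_apply_cons _ _ hE

lemma chainLaw_pure {X : Type*} [Fintype X] [MeasurableSpace X] [MeasurableSingletonClass X]
    (x : X) (step : ℕ → X → PMF X) {E : Set (ℕ → X)} (hE : MeasurableSet E) :
    chainLaw (PMF.pure x) step E =
      chainLaw (step 0 x) (fun n => step (n + 1)) (pathCons x ⁻¹' E) := by
  classical
  rw [chainLaw_apply_cons _ _ hE, Finset.sum_eq_single x]
  · simp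
  · intro b _ hb
    simp [hb]
  · simp

/-- If communication is available at time `0`, imaginary play draws a shared joint state-action
pair and goes on with communication available for one step less. -/
lemma imgPathLaw_cons (ν : PMF (StateAction S A)) (k : ℕ∞) (E : Set (ℕ → StateAction S A))
    (hE : MeasurableSet E) :
    imgPathLaw G π ν (k + 1) E =
      ∑ x, ν x * imgPathLaw G π (jointStep G π x) k (pathCons x ⁻¹' E) := by
  classical
  have hE' := measurable_actual_path hE
  rw [imgPathLaw, Measure.map_apply measurable_actual_path hE, recordLaw, if_pos (by simp),
    ← PMF.bind_pure_comp, chainLaw_bind]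
  refine Finset.sum_congr rfl fun x _ => ?_
  congr 1
  rw [Function.comp, chainLaw_pure _ _ hE', imgPathLaw,
    Measure.map_apply measurable_actual_path (measurable_pathCons x hE), recordLaw]
  have h1 : imgStep G π (((0 + 1 : ℕ) : ℕ∞) < k + 1) (fun _ => x) =
      if 0 < k then (jointStep G π x).map fun x _ => x else pmfPi fun _ => jointStep G π x := by
    unfold imgStep
    have : ((0 + 1 : ℕ) : ℕ∞) < k + 1 ↔ 0 < k := by
      rw [Nat.cast_add, Nat.cast_one, Nat.cast_zero]
      exact ENat.add_lt_add_iff_right (by simp)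
    simp only [this]
    rfl
  have h2 : (fun n => imgStep G π (((n + 1 + 1 : ℕ) : ℕ∞) < k + 1)) =
      fun n => imgStep G π (((n + 1 : ℕ) : ℕ∞) < k) := by
    funext n r
    unfold imgStep
    have : ((n + 1 + 1 : ℕ) : ℕ∞) < k + 1 ↔ ((n + 1 : ℕ) : ℕ∞) < k := by
      rw [Nat.cast_add, Nat.cast_one]
      exact ENat.add_lt_add_iff_right (by simp)
    simp only [this]
  rw [h1, h2]
  congr 1
  ext ω
  simp only [Set.mem_preimage]
  refine iff_of_eq (congrArg (· ∈ E) ?_)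
  ext t
  · cases t <;> rfl
  · cases t <;> rfl

/-- Without any communication, the agents' paths are independent, and each of them has the same law
as with full communication. -/
lemma prefixProb_imgPathLaw_zero (ν : PMF (StateAction S A)) (T : ℕ)
    (z : Fin T → StateAction S A) :
    prefixProb (imgPathLaw G π ν 0) T z =
      prodMarg (prefixProb (pathLaw G π ν) T) (agentPath T) z := by
  classical
  unfold prefixProb prodMarg
  change _ = ∏ i, marg (prefixProb (pathLaw G π ν) T) _ _
  simp_rw [marg_prefixProb]
  rw [Measure.real, imgPathLaw, Measure.map_apply measurable_actual_path
    (measurable_pathPrefix _ (measurableSet_singleton _)), recordLaw, if_neg (by simp)]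
  have h := chainLaw_pmfPi_real_obs (X := StateAction S A) (Y := fun i => S i × A i)
    (fun i x => (x.1 i, x.2 i)) (jointStep G π) T (fun _ => ν) fun i t => agentPath T i z t
  have h2 : (fun n => imgStep G π (((n + 1 : ℕ) : ℕ∞) < 0)) =
      fun _ r => pmfPi fun i => jointStep G π (r i) := by
    funext n r
    exact if_neg (by simp)
  rw [h2]
  refine Eq.trans ?_ (h.trans ?_)
  · rw [Measure.real]
    congr 2
    ext ω
    simp only [Set.mem_preimage, Set.mem_singleton_iff, funext_iff]
    refine forall_congr' fun t => ?_
    rw [← agent_injective.eq_iff, funext_iff]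
    rfl
  · refine Finset.prod_congr rfl fun i _ => ?_
    congr 1
    ext ω
    simp only [Set.mem_preimage, Set.mem_singleton_iff, funext_iff]
    rfl

/-- The divergence of the joint path with full communication from the joint path under imaginary
play is at most the total correlation, whenever the communication is lost. -/
lemma kl_le_tc (T : ℕ) (ν : PMF (StateAction S A)) (k : ℕ∞) :
    (∀ z, prefixProb (pathLaw G π ν) T z ≠ 0 → prefixProb (imgPathLaw G π ν k) T z ≠ 0) ∧
      kl (prefixProb (pathLaw G π ν) T) (prefixProb (imgPathLaw G π ν k) T) ≤
        tc (prefixProb (pathLaw G π ν) T) (agentPath T) := by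
  classical
  induction T generalizing ν k with
  | zero =>
    have h : ∀ (μ : Measure (ℕ → StateAction S A)) [IsProbabilityMeasure μ]
        (z : Fin 0 → StateAction S A), prefixProb μ 0 z = 1 := by
      intro μ _ z
      have := sum_prefixProb μ 0
      rwa [Fintype.sum_unique, Subsingleton.elim default z] at this
    refine ⟨fun z _ => by simp [h], ?_⟩
    refine le_trans (le_of_eq ?_) (tc_nonneg (prefixProb_nonneg _ _) (sum_prefixProb _ _) _
      (agentPath_injective 0))
    simp [kl, h]
  | succ T ih =>
    rcases eq_or_ne k 0 with rfl | hk
    -- communication lost at once: the law of imaginary play is the product of the marginals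
    · have hQ : prefixProb (imgPathLaw G π ν 0) (T + 1) =
          prodMarg (prefixProb (pathLaw G π ν) (T + 1)) (agentPath (T + 1)) :=
        funext fun z => prefixProb_imgPathLaw_zero G π ν _ z
      rw [hQ]
      exact ⟨fun z => prodMarg_ne_zero (prefixProb_nonneg _ _) _,
        (kl_prodMarg (prefixProb_nonneg _ _) _).le⟩
    -- communication at time `0`: condition on the first, shared entry
    · obtain ⟨k, rfl⟩ : ∃ k', k = k' + 1 :=
        ⟨k - 1, (tsub_add_cancel_of_le (Order.one_le_iff_ne_zero.2 hk)).symm⟩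
      have hP := prefixProb_cons (pathLaw_cons G π ν) T
      have hQ := prefixProb_cons (imgPathLaw_cons G π ν k) T
      refine ⟨fun z hz => ?_, ?_⟩
      · rw [← Fin.cons_self_tail z, hP] at hz
        rw [← Fin.cons_self_tail z, hQ]
        exact mul_ne_zero (left_ne_zero_of_mul hz) ((ih _ k).1 _ (right_ne_zero_of_mul hz))
      · rw [kl_joint (Fin.consEquiv fun _ => StateAction S A)
          (ν := fun x => (ν x).toReal) (fun x z _ => (ih (jointStep G π x) k).1 z) hP hQ]
        refine (Finset.sum_le_sum fun x _ => mul_le_mul_of_nonneg_left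
          (ih (jointStep G π x) k).2 ENNReal.toReal_nonneg).trans ?_
        refine sum_mul_tc_le (Fin.consEquiv fun _ => StateAction S A)
          (fun i => Fin.consEquiv fun _ => S i × A i)
          (q := fun i x => (x.1 i, x.2 i)) ?_ agent_injective
          (fun _ => ENNReal.toReal_nonneg) ?_ (fun _ => prefixProb_nonneg _ _)
          (fun _ => sum_prefixProb _ _) hP
        · intro i x z
          funext t
          refine Fin.cases ?_ (fun t => ?_) t <;> rfl
        · rw [← ENNReal.toReal_sum fun x _ => ν.apply_ne_top x,
            ← tsum_fintype (L := .unconditional _), ν.tsum_coe, ENNReal.toReal_one]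

/-- As long as communication is available, imaginary play has the law of full communication. -/
lemma prefixProb_imgPathLaw_of_le (T : ℕ) (ν : PMF (StateAction S A)) (k : ℕ∞)
    (hk : (T : ℕ∞) ≤ k) (z : Fin T → StateAction S A) :
    prefixProb (imgPathLaw G π ν k) T z = prefixProb (pathLaw G π ν) T z := by
  classical
  induction T generalizing ν k with
  | zero =>
    have h1 := sum_prefixProb (imgPathLaw G π ν k) 0
    have h2 := sum_prefixProb (pathLaw G π ν) 0
    rw [Fintype.sum_unique, Subsingleton.elim default z] at h1 h2
    rw [h1, h2]
  | succ T ih =>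
    obtain ⟨k, rfl⟩ : ∃ k', k = k' + 1 :=
      ⟨k - 1, (tsub_add_cancel_of_le (le_trans (by simp) hk)).symm⟩
    have hk' : (T : ℕ∞) ≤ k := by
      rw [Nat.cast_add, Nat.cast_one] at hk
      exact (ENat.add_le_add_iff_right (by simp)).1 hk
    rw [← Fin.cons_self_tail z, prefixProb_cons (pathLaw_cons G π ν) T,
      prefixProb_cons (imgPathLaw_cons G π ν k) T, ih _ k hk']

lemma totalCorrelationUpTo_eq_tc (T : ℕ) :
    totalCorrelationUpTo G π T = tc (prefixProb (fullLaw G π) T) (agentPath T) := by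
  classical
  unfold totalCorrelationUpTo tc
  congr 1
  refine Finset.sum_congr rfl fun i _ => ?_
  unfold entropy ent
  simp_rw [marg_prefixProb]
  rfl

end Game

/-! ### Success and hitting times -/

section Events

variable {N : ℕ} {S : Fin N → Type*} {A : Fin N → Type*}

/-- The joint paths that meet `target` at time `n`, and neither `target` nor `avoid` before. -/
def hitAt (target avoid : Set (∀ i, S i)) (n : ℕ) : Set (ℕ → StateAction S A) :=
  {ω | (ω n).1 ∈ target ∧ ∀ t < n, (ω t).1 ∉ target ∧ (ω t).1 ∉ avoid}

/-- The joint paths that do not meet `B` at the times `t < n`. -/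
def notHit (B : Set (∀ i, S i)) (n : ℕ) : Set (ℕ → StateAction S A) :=
  {ω | ∀ t < n, (ω t).1 ∉ B}

/-- The joint paths that succeed before time `T`. -/
def successBefore (target avoid : Set (∀ i, S i)) (T : ℕ) : Set (ℕ → StateAction S A) :=
  {ω | ∃ M < T, (ω M).1 ∈ target ∧ ∀ t < M, (ω t).1 ∉ avoid}

lemma success_eq_iUnion_hitAt (target avoid : Set (∀ i, S i)) :
    (Success target avoid : Set (ℕ → StateAction S A)) = ⋃ n, hitAt target avoid n := by
  classical
  ext ω
  simp only [Success, hitAt, Set.mem_ofPred_eq, Set.mem_iUnion]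
  constructor
  · rintro ⟨M, hM, hA⟩
    have h : ∃ n, (ω n).1 ∈ target := ⟨M, hM⟩
    exact ⟨Nat.find h, Nat.find_spec h, fun t ht => ⟨Nat.find_min h ht,
      hA t (ht.trans_le (Nat.find_min' h hM))⟩⟩
  · rintro ⟨n, hn, hA⟩
    exact ⟨n, hn, fun t ht => (hA t ht).2⟩

lemma eq_of_mem_hitAt {target avoid : Set (∀ i, S i)} {m n : ℕ} {ω : ℕ → StateAction S A}
    (hm : ω ∈ hitAt target avoid m) (hn : ω ∈ hitAt target avoid n) : m = n := by
  rcases lt_trichotomy m n with h | h | h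
  · exact absurd hm.1 (hn.2 m h).1
  · exact h
  · exact absurd hn.1 (hm.2 n h).1

lemma pairwise_disjoint_hitAt (target avoid : Set (∀ i, S i)) :
    Pairwise (Function.onFun Disjoint
      (hitAt target avoid : ℕ → Set (ℕ → StateAction S A))) := fun _ _ hmn =>
  Set.disjoint_left.2 fun _ hm hn => hmn (eq_of_mem_hitAt hm hn)

lemma hitAt_eq_preimage (target avoid : Set (∀ i, S i)) (n : ℕ) :
    (hitAt target avoid n : Set (ℕ → StateAction S A)) = pathPrefix (n + 1) ⁻¹'
      {z | (z (Fin.last n)).1 ∈ target ∧ ∀ t < Fin.last n, (z t).1 ∉ target ∧ (z t).1 ∉ avoid} := by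
  ext ω
  simp only [hitAt, Set.mem_ofPred_eq, Set.mem_preimage, pathPrefix, Fin.val_last]
  refine and_congr_right fun _ => ⟨fun h t ht => h t ht, fun h t ht => ?_⟩
  exact h ⟨t, by omega⟩ ht

lemma successBefore_eq_preimage (target avoid : Set (∀ i, S i)) (T : ℕ) :
    (successBefore target avoid T : Set (ℕ → StateAction S A)) = pathPrefix T ⁻¹'
      {z | ∃ M, (z M).1 ∈ target ∧ ∀ t < M, (z t).1 ∉ avoid} := by
  ext ω
  simp only [successBefore, Set.mem_ofPred_eq, Set.mem_preimage, pathPrefix]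
  constructor
  · rintro ⟨M, hM, h1, h2⟩
    exact ⟨⟨M, hM⟩, h1, fun t ht => h2 t ht⟩
  · rintro ⟨M, h1, h2⟩
    exact ⟨M, M.2, h1, fun t ht => h2 ⟨t, ht.trans M.2⟩ ht⟩

lemma monotone_successBefore (target avoid : Set (∀ i, S i)) :
    Monotone (successBefore target avoid : ℕ → Set (ℕ → StateAction S A)) :=
  fun _ _ h _ ⟨M, hM, h'⟩ => ⟨M, hM.trans_le h, h'⟩

lemma iUnion_successBefore (target avoid : Set (∀ i, S i)) :
    ⋃ T, (successBefore target avoid T : Set (ℕ → StateAction S A)) = Success target avoid := by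
  ext ω
  simp only [successBefore, Success, Set.mem_ofPred_eq, Set.mem_iUnion]
  exact ⟨fun ⟨_, M, _, h⟩ => ⟨M, h⟩, fun ⟨M, h⟩ => ⟨M + 1, M, M.lt_succ_self, h⟩⟩

variable [∀ i, Fintype (S i)] [∀ i, MeasurableSpace (S i)] [∀ i, MeasurableSingletonClass (S i)]
  [∀ i, Fintype (A i)] [∀ i, MeasurableSpace (A i)] [∀ i, MeasurableSingletonClass (A i)]

lemma measurableSet_state (B : Set (∀ i, S i)) (t : ℕ) :
    MeasurableSet {ω : ℕ → StateAction S A | (ω t).1 ∈ B} :=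
  (Set.toFinite {x : StateAction S A | x.1 ∈ B}).measurableSet.preimage (measurable_pi_apply t)

lemma measurableSet_prefix {T : ℕ} (E : Set (Fin T → StateAction S A)) :
    MeasurableSet (pathPrefix T ⁻¹' E) :=
  measurable_pathPrefix T (Set.toFinite E).measurableSet

lemma measurableSet_hitAt (target avoid : Set (∀ i, S i)) (n : ℕ) :
    MeasurableSet (hitAt target avoid n : Set (ℕ → StateAction S A)) := by
  rw [hitAt_eq_preimage]
  exact measurableSet_prefix _

lemma measurableSet_success (target avoid : Set (∀ i, S i)) :
    MeasurableSet (Success target avoid : Set (ℕ → StateAction S A)) := by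
  rw [success_eq_iUnion_hitAt]
  exact MeasurableSet.iUnion fun n => measurableSet_hitAt _ _ n

lemma measurableSet_notHit (B : Set (∀ i, S i)) (n : ℕ) :
    MeasurableSet (notHit B n : Set (ℕ → StateAction S A)) := by
  have : (notHit B n : Set (ℕ → StateAction S A)) = ⋂ t, ⋂ (_ : t < n), {ω | (ω t).1 ∈ B}ᶜ := by
    ext; simp [notHit]
  rw [this]
  exact MeasurableSet.iInter fun t => MeasurableSet.iInter fun _ => (measurableSet_state B t).compl

end Events

section Values

variable {N : ℕ} {S : Fin N → Type*} {A : Fin N → Type*}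
  [∀ i, Fintype (S i)] [∀ i, MeasurableSpace (S i)] [∀ i, MeasurableSingletonClass (S i)]
  [∀ i, Fintype (A i)] [∀ i, MeasurableSpace (A i)] [∀ i, MeasurableSingletonClass (A i)]
  (G : ∀ i, MDP (S i) (A i)) (π : (∀ i, S i) → PMF (∀ i, A i))

instance (k : ℕ∞) : IsProbabilityMeasure (imgLawAt G π k) := by
  rw [imgLawAt_eq_imgPathLaw]
  infer_instance

lemma imgLaw_apply (τ : PMF ℕ∞) {E : Set (ℕ → StateAction S A)} (hE : MeasurableSet E) :
    imgLaw G π τ E = ∑' k : ℕ∞, τ k * imgLawAt G π k E := by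
  rw [imgLaw, Measure.sum_apply _ hE]
  rfl

instance (τ : PMF ℕ∞) : IsProbabilityMeasure (imgLaw G π τ) :=
  ⟨by rw [imgLaw_apply _ _ _ .univ]; simp [τ.tsum_coe]⟩

/-! ### The bound by the total correlation -/

lemma exp_neg_totalCorrelation_le (T : ℕ) :
    (EReal.exp (-(totalCorrelation G π))).toReal ≤ Real.exp (-(totalCorrelationUpTo G π T)) := by
  have h : -(totalCorrelation G π) ≤ ((-(totalCorrelationUpTo G π T) : ℝ) : EReal) := by
    rw [EReal.coe_neg, EReal.neg_le_neg_iff]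
    exact le_iSup (fun T => (totalCorrelationUpTo G π T : EReal)) T
  have h2 := EReal.exp_monotone h
  rw [EReal.exp_coe] at h2
  exact ENNReal.toReal_le_of_le_ofReal (Real.exp_pos _).le h2

lemma fullLaw_real_successBefore_sub_le (target avoid : Set (∀ i, S i)) (k : ℕ∞) (T : ℕ) :
    (fullLaw G π).real (successBefore target avoid T) -
        (imgLawAt G π k).real (successBefore target avoid T) ≤
      Real.sqrt (1 - (EReal.exp (-(totalCorrelation G π))).toReal) := by
  classical
  rw [imgLawAt_eq_imgPathLaw, fullLaw_eq_pathLaw, successBefore_eq_preimage]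
  set ν := drawAction π (jointInit G)
  obtain ⟨hac, hkl⟩ := kl_le_tc G π T ν k
  have h := sub_le_sqrt_one_sub_exp_neg_kl (prefixProb_nonneg (pathLaw G π ν) T)
    (sum_prefixProb _ T) (prefixProb_nonneg (imgPathLaw G π ν k) T) (sum_prefixProb _ T) hac
    (Set.toFinite {z : Fin T → StateAction S A |
      ∃ M, (z M).1 ∈ target ∧ ∀ t < M, (z t).1 ∉ avoid}).toFinset
  rw [sum_prefixProb_eq_real, sum_prefixProb_eq_real, Set.Finite.coe_toFinset] at h
  refine h.trans (Real.sqrt_le_sqrt ?_)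
  have h1 := exp_neg_totalCorrelation_le G π T
  rw [totalCorrelationUpTo_eq_tc] at h1
  have h2 := Real.exp_le_exp.2 (neg_le_neg hkl)
  rw [fullLaw_eq_pathLaw] at h1
  linarith

lemma tendsto_real_successBefore {N : ℕ} {S : Fin N → Type*} {A : Fin N → Type*}
    [∀ i, MeasurableSpace (S i)] [∀ i, MeasurableSpace (A i)]
    (μ : Measure (ℕ → StateAction S A)) [IsProbabilityMeasure μ]
    (target avoid : Set (∀ i, S i)) :
    Filter.Tendsto (fun T => μ.real (successBefore target avoid T)) Filter.atTop
      (nhds (μ.real (Success target avoid))) := by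
  rw [← iUnion_successBefore]
  exact (ENNReal.tendsto_toReal (measure_ne_top _ _)).comp
    (tendsto_measure_iUnion_atTop (monotone_successBefore target avoid))

lemma fullLaw_real_success_sub_le (target avoid : Set (∀ i, S i)) (k : ℕ∞) :
    (fullLaw G π).real (Success target avoid) -
        (imgLawAt G π k).real (Success target avoid) ≤
      Real.sqrt (1 - (EReal.exp (-(totalCorrelation G π))).toReal) :=
  le_of_tendsto' ((tendsto_real_successBefore _ target avoid).sub
    (tendsto_real_successBefore _ target avoid))
    fun T => fullLaw_real_successBefore_sub_le G π target avoid k T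

lemma imgLaw_real_success_ge_sub (target avoid : Set (∀ i, S i)) (τ : PMF ℕ∞) :
    (fullLaw G π).real (Success target avoid) -
        Real.sqrt (1 - (EReal.exp (-(totalCorrelation G π))).toReal) ≤
      (imgLaw G π τ).real (Success target avoid) := by
  set c := (fullLaw G π).real (Success target avoid) -
    Real.sqrt (1 - (EReal.exp (-(totalCorrelation G π))).toReal)
  have h : ENNReal.ofReal c ≤ imgLaw G π τ (Success target avoid) := by
    rw [imgLaw_apply _ _ _ (measurableSet_success _ _)]
    calc ENNReal.ofReal c = ∑' k, τ k * ENNReal.ofReal c := by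
          rw [ENNReal.tsum_mul_right, τ.tsum_coe, one_mul]
      _ ≤ _ := by
          refine ENNReal.tsum_le_tsum fun k => mul_le_mul_right ?_ _
          refine ENNReal.ofReal_le_of_le_toReal ?_
          have := fullLaw_real_success_sub_le G π target avoid k
          rw [Measure.real, Measure.real] at this
          simp only [c, Measure.real]
          linarith
  exact (ENNReal.ofReal_le_iff_le_toReal (measure_ne_top _ _)).1 h

/-! ### The Markov property and the expected path length -/

lemma fst_eq_of_drawAction_ne_zero {N : ℕ} {S : Fin N → Type*} {A : Fin N → Type*}
    (π : (∀ i, S i) → PMF (∀ i, A i)) {s : ∀ i, S i} {x : StateAction S A}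
    (hx : drawAction π s x ≠ 0) : x.1 = s := by
  have := (PMF.mem_support_iff _ _).2 hx
  rw [drawAction, PMF.support_map] at this
  obtain ⟨a, _, rfl⟩ := this
  rfl

/-- The Markov property of the joint states at the first step. -/
lemma fullLawFrom_cons (s : ∀ i, S i) {E : Set (ℕ → StateAction S A)} (hE : MeasurableSet E) :
    fullLawFrom G π s E = ∑ x, drawAction π s x *
      ∑ y, jointTrans G x y * fullLawFrom G π y (pathCons x ⁻¹' E) := by
  rw [fullLawFrom, chainLaw_apply_cons _ _ hE]
  refine Finset.sum_congr rfl fun x _ => ?_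
  rw [jointStep, chainLaw_bind]
  rfl

lemma fullLawFrom_zero_ne (s : ∀ i, S i) :
    fullLawFrom G π s {ω | (ω 0).1 ∉ ({s} : Set (∀ i, S i))} = 0 := by
  have hm := (measurableSet_state (A := A) ({s} : Set (∀ i, S i)) 0).compl
  change fullLawFrom G π s {ω | (ω 0).1 ∈ ({s} : Set (∀ i, S i))}ᶜ = 0
  rw [fullLawFrom_cons G π s hm]
  refine Finset.sum_eq_zero fun x _ => ?_
  by_cases hx : drawAction π s x = 0
  · simp [hx]
  · have := fst_eq_of_drawAction_ne_zero π hx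
    rw [show pathCons x ⁻¹' {ω : ℕ → StateAction S A | (ω 0).1 ∈ ({s} : Set (∀ i, S i))}ᶜ = ∅ by
      ext ω; simp [this]]
    simp

/-- If from every joint state `B` is missed for `n` steps with probability at most `c`, then missing
it for `n` further steps costs a factor `c`. -/
lemma fullLawFrom_notHit_add_le (B : Set (∀ i, S i)) {n : ℕ} {c : ℝ≥0∞}
    (hc : ∀ s, fullLawFrom G π s (notHit B n) ≤ c) (m : ℕ) (s : ∀ i, S i) :
    fullLawFrom G π s (notHit B (m + n)) ≤ fullLawFrom G π s (notHit B m) * c := by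
  induction m generalizing s with
  | zero =>
    rw [show (notHit B 0 : Set (ℕ → StateAction S A)) = Set.univ by ext; simp [notHit]]
    simpa using hc s
  | succ m ih =>
    rw [fullLawFrom_cons G π s (measurableSet_notHit _ _),
      fullLawFrom_cons G π s (measurableSet_notHit B (m + 1)), Finset.sum_mul]
    refine Finset.sum_le_sum fun x _ => ?_
    rw [mul_assoc, Finset.sum_mul]
    refine mul_le_mul_right (Finset.sum_le_sum fun y _ => ?_) _
    rw [mul_assoc]
    refine mul_le_mul_right ?_ _
    have h : ∀ j, pathCons x ⁻¹' (notHit B (j + 1) : Set (ℕ → StateAction S A)) =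
        {ω | x.1 ∉ B ∧ ω ∈ notHit B j} := by
      intro j
      ext ω
      simp only [Set.mem_preimage, notHit, Set.mem_ofPred_eq]
      refine ⟨fun H => ⟨H 0 (by omega), fun t ht => H (t + 1) (by omega)⟩, ?_⟩
      rintro ⟨h0, H⟩ (_ | t) ht
      · exact h0
      · exact H t (by omega)
    rw [add_right_comm, h, h]
    by_cases hx : x.1 ∈ B
    · simp [hx]
    · simpa [hx] using ih y

lemma fullLawFrom_notHit_mul_le (B : Set (∀ i, S i)) {n : ℕ} {c : ℝ≥0∞}
    (hc : ∀ s, fullLawFrom G π s (notHit B n) ≤ c) (k : ℕ) (s : ∀ i, S i) :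
    fullLawFrom G π s (notHit B (k * n)) ≤ c ^ k := by
  induction k with
  | zero => simpa using prob_le_one
  | succ k ih =>
    rw [Nat.succ_mul, pow_succ]
    exact (fullLawFrom_notHit_add_le G π B hc _ s).trans (mul_le_mul_left ih c)

/-- In blocks of `n` steps: `B` is missed throughout the first `k` blocks for at least
`pathLength B ω / n` many `k`. -/
lemma pathLength_le_tsum {N : ℕ} {S : Fin N → Type*} {A : Fin N → Type*} (B : Set (∀ i, S i))
    {n : ℕ} (hn : n ≠ 0) (ω : ℕ → StateAction S A) :
    pathLength B ω ≤ n * ∑' k : ℕ, (notHit B (k * n)).indicator 1 ω := by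
  classical
  by_cases h : ∃ k, ω ∉ (notHit B (k * n) : Set (ℕ → StateAction S A))
  · have hk := Nat.find_spec h
    have hmin : ∀ j < Nat.find h, ω ∈ (notHit B (j * n) : Set (ℕ → StateAction S A)) :=
      fun j hj => not_not.1 (Nat.find_min h hj)
    set k := Nat.find h
    simp only [notHit, Set.mem_ofPred_eq, not_forall, not_not] at hk
    obtain ⟨t, ht, htB⟩ := hk
    calc pathLength B ω ≤ ((t + 1 : ℕ) : ℝ≥0∞) := iInf₂_le t htB
      _ ≤ ((k * n : ℕ) : ℝ≥0∞) := by exact_mod_cast ht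
      _ = n * ∑ j ∈ Finset.range k, (notHit B (j * n)).indicator 1 ω := by
          rw [Finset.sum_congr rfl fun j hj =>
            Set.indicator_of_mem (hmin j (Finset.mem_range.1 hj)) 1]
          simp [mul_comm]
      _ ≤ _ := mul_le_mul_right (ENNReal.sum_le_tsum _) _
  · push Not at h
    have : ∑' k : ℕ, (notHit B (k * n)).indicator (1 : (ℕ → StateAction S A) → ℝ≥0∞) ω = ∞ := by
      simp [h]
    rw [this, ENNReal.mul_top (by exact_mod_cast hn)]
    exact le_top

/-- If `B` can be reached from every joint state, the expected path length up to `B` is finite. -/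
lemma lintegral_pathLength_ne_top (B : Set (∀ i, S i))
    (hB : ∀ s, ∃ n, fullLawFrom G π s (notHit B n) < 1) (s₀ : ∀ i, S i) :
    ∫⁻ ω, pathLength B ω ∂(fullLawFrom G π s₀) ≠ ∞ := by
  classical
  choose f hf using hB
  -- a number of steps `n` and a bound `c < 1` that serve all joint states at once
  set n := Finset.univ.sup f + 1
  set c := Finset.univ.sup fun s => fullLawFrom G π s (notHit B n)
  have hc : ∀ s, fullLawFrom G π s (notHit B n) ≤ c := fun s =>
    Finset.le_sup (f := fun s => fullLawFrom G π s (notHit B n)) (Finset.mem_univ s)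
  have hc1 : c < 1 := by
    refine (Finset.sup_lt_iff (by simp)).2 fun s _ => (measure_mono ?_).trans_lt (hf s)
    intro ω hω t ht
    exact hω t (ht.trans_le ((Finset.le_sup (Finset.mem_univ s)).trans (Nat.le_succ _)))
  have h : ∫⁻ ω, pathLength B ω ∂(fullLawFrom G π s₀) ≤ n * ∑' k : ℕ, c ^ k := by
    calc ∫⁻ ω, pathLength B ω ∂(fullLawFrom G π s₀)
        ≤ ∫⁻ ω, n * ∑' k : ℕ, (notHit B (k * n)).indicator 1 ω ∂(fullLawFrom G π s₀) :=
          lintegral_mono fun ω => pathLength_le_tsum B (Nat.succ_ne_zero _) ω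
      _ = n * ∑' k : ℕ, fullLawFrom G π s₀ (notHit B (k * n)) := by
          have hm : ∀ k : ℕ, Measurable ((notHit B (k * n) :
              Set (ℕ → StateAction S A)).indicator (1 : (ℕ → StateAction S A) → ℝ≥0∞)) :=
            fun k => measurable_one.indicator (measurableSet_notHit _ _)
          rw [lintegral_const_mul _ (Measurable.tsum hm),
            lintegral_tsum fun k => (hm k).aemeasurable]
          simp_rw [lintegral_indicator_one (measurableSet_notHit B _)]
      _ ≤ n * ∑' k : ℕ, c ^ k :=
          mul_le_mul_right (ENNReal.tsum_le_tsum fun k =>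
            fullLawFrom_notHit_mul_le G π B hc k s₀) _
  refine ne_top_of_le_ne_top ?_ h
  rw [ENNReal.tsum_geometric]
  exact ENNReal.mul_ne_top (by simp) (ENNReal.inv_ne_top.2 (tsub_pos_of_lt hc1).ne')

lemma success_subset_reach {N : ℕ} {S : Fin N → Type*} {A : Fin N → Type*}
    (target avoid : Set (∀ i, S i)) :
    (Success target avoid : Set (ℕ → StateAction S A)) ⊆ {ω | ∃ t, (ω t).1 ∈ target} :=
  fun _ ⟨M, hM, _⟩ => ⟨M, hM⟩

/-- For either choice of the dead states, `target` can be reached from every other state. -/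
lemma reach_ne_zero_of_notMem_dead {target avoid dead : Set (∀ i, S i)}
    (hdead : dead = deadReach G π target ∨ dead = deadReachAvoid G π target avoid)
    {s : ∀ i, S i} (hs : s ∉ dead) :
    fullLawFrom G π s {ω | ∃ t, (ω t).1 ∈ target} ≠ 0 := by
  rcases hdead with rfl | rfl
  · exact hs
  · exact fun h => hs (measure_mono_null (success_subset_reach target avoid) h)

/-- For either choice of the dead states, success from a dead state has probability `0`. -/
lemma success_eq_zero_of_mem_dead {target avoid dead : Set (∀ i, S i)}
    (hdead : dead = deadReach G π target ∨ dead = deadReachAvoid G π target avoid)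
    {s : ∀ i, S i} (hs : s ∈ dead) : fullLawFrom G π s (Success target avoid) = 0 := by
  rcases hdead with rfl | rfl
  · exact measure_mono_null (success_subset_reach target avoid) hs
  · exact hs

lemma exists_notHit_lt_one {target avoid dead : Set (∀ i, S i)}
    (hdead : dead = deadReach G π target ∨ dead = deadReachAvoid G π target avoid)
    (s : ∀ i, S i) : ∃ n, fullLawFrom G π s (notHit (target ∪ dead) n) < 1 := by
  by_cases hs : s ∈ dead
  · refine ⟨1, lt_of_le_of_lt (le_of_eq ?_) zero_lt_one⟩
    refine measure_mono_null (fun ω hω => ?_) (fullLawFrom_zero_ne G π s)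
    intro h0
    exact hω 0 one_pos (Or.inr ((Set.mem_singleton_iff.1 h0).symm ▸ hs))
  · have h := reach_ne_zero_of_notMem_dead G π hdead hs
    rw [Set.ofPred_exists] at h
    obtain ⟨t, ht⟩ : ∃ t, fullLawFrom G π s {ω | (ω t).1 ∈ target} ≠ 0 := by
      by_contra! H
      exact h (measure_iUnion_null H)
    refine ⟨t + 1, (measure_mono (t := {ω | (ω t).1 ∈ target}ᶜ) ?_).trans_lt ?_⟩
    · intro ω hω h'
      exact hω t t.lt_succ_self (Or.inl h')
    · rw [prob_compl_eq_one_sub (measurableSet_state _ _)]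
      exact ENNReal.sub_lt_self ENNReal.one_ne_top one_ne_zero ht

lemma expectedLength_ne_top {target avoid dead : Set (∀ i, S i)}
    (hdead : dead = deadReach G π target ∨ dead = deadReachAvoid G π target avoid) :
    expectedLength G π target dead ≠ ∞ :=
  lintegral_pathLength_ne_top G π _ (exists_notHit_lt_one G π hdead) _

/-- Almost no path succeeds after a visit to `dead`. -/
lemma fullLawFrom_dead_success {target avoid dead : Set (∀ i, S i)}
    (hdead : ∀ s ∈ dead, fullLawFrom G π s (Success target avoid) = 0) (t : ℕ) (s : ∀ i, S i) :
    fullLawFrom G π s {ω | (ω t).1 ∈ dead ∧ ω ∈ notHit target t ∧ ω ∈ Success target avoid}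
      = 0 := by
  induction t generalizing s with
  | zero =>
    by_cases hs : s ∈ dead
    · exact measure_mono_null (fun ω h => h.2.2) (hdead s hs)
    · refine measure_mono_null (fun ω h => ?_) (fullLawFrom_zero_ne G π s)
      intro h0
      exact hs ((Set.mem_singleton_iff.1 h0) ▸ h.1)
  | succ t ih =>
    have hm : MeasurableSet {ω : ℕ → StateAction S A | (ω (t + 1)).1 ∈ dead ∧
        ω ∈ notHit target (t + 1) ∧ ω ∈ Success target avoid} :=
      (measurableSet_state _ _).inter
        ((measurableSet_notHit _ _).inter (measurableSet_success _ _))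
    rw [fullLawFrom_cons G π s hm]
    refine Finset.sum_eq_zero fun x _ => ?_
    rw [Finset.sum_eq_zero, mul_zero]
    intro y _
    rw [measure_mono_null _ (ih y), mul_zero]
    rintro ω ⟨h1, h2, M, h3, h4⟩
    refine ⟨h1, fun u hu => h2 (u + 1) (by omega), ?_⟩
    cases M with
    | zero => exact absurd h3 (h2 0 (by omega))
    | succ M => exact ⟨M, h3, fun u hu => h4 (u + 1) (by omega)⟩

/-- Successful paths have, almost surely, met `target` for the first time at the end of their
length, so they alone contribute this sum to the expected length. -/
lemma tsum_hitAt_mul_le_expectedLength {target avoid dead : Set (∀ i, S i)}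
    (hdead : ∀ s ∈ dead, fullLawFrom G π s (Success target avoid) = 0) :
    ∑' n : ℕ, fullLaw G π (hitAt target avoid n) * ((n + 1 : ℕ) : ℝ≥0∞) ≤
      expectedLength G π target dead := by
  have hae : ∀ᵐ ω ∂(fullLaw G π), ∀ t, ¬ ((ω t).1 ∈ dead ∧ ω ∈ notHit target t ∧
      ω ∈ Success target avoid) := by
    refine ae_all_iff.2 fun t => ?_
    rw [ae_iff]
    simp only [not_not]
    exact fullLawFrom_dead_success G π hdead t (jointInit G)
  have hm : ∀ n : ℕ, Measurable ((hitAt target avoid n : Set (ℕ → StateAction S A)).indicator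
      fun _ => ((n + 1 : ℕ) : ℝ≥0∞)) := fun n =>
    measurable_const.indicator (measurableSet_hitAt _ _ n)
  calc ∑' n : ℕ, fullLaw G π (hitAt target avoid n) * ((n + 1 : ℕ) : ℝ≥0∞)
      = ∫⁻ ω, ∑' n : ℕ, (hitAt target avoid n).indicator (fun _ => ((n + 1 : ℕ) : ℝ≥0∞)) ω
          ∂(fullLaw G π) := by
        rw [lintegral_tsum fun n => (hm n).aemeasurable]
        refine tsum_congr fun n => ?_
        rw [lintegral_indicator_const (measurableSet_hitAt _ _ n), mul_comm]
    _ ≤ expectedLength G π target dead := by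
        refine lintegral_mono_ae ?_
        filter_upwards [hae] with ω hω
        by_cases h : ∃ n, ω ∈ (hitAt target avoid n : Set (ℕ → StateAction S A))
        · obtain ⟨n, hn⟩ := h
          rw [tsum_eq_single n fun m hmn =>
            Set.indicator_of_notMem (fun hm => hmn (eq_of_mem_hitAt hm hn)) _,
            Set.indicator_of_mem hn]
          refine le_iInf₂ fun t ht => ?_
          have hnt : n ≤ t := by
            by_contra! hlt
            rcases ht with ht | ht
            · exact (hn.2 t hlt).1 ht
            · refine hω t ⟨ht, fun u hu => (hn.2 u (hu.trans hlt)).1, ?_⟩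
              rw [success_eq_iUnion_hitAt]
              exact Set.mem_iUnion.2 ⟨n, hn⟩
          exact_mod_cast Nat.succ_le_succ hnt
        · push Not at h
          simp [h]

/-! ### The bound by the expected path length -/

lemma imgLawAt_hitAt (target avoid : Set (∀ i, S i)) (n : ℕ) {k : ℕ∞}
    (hk : ((n + 1 : ℕ) : ℕ∞) ≤ k) :
    imgLawAt G π k (hitAt target avoid n) = fullLaw G π (hitAt target avoid n) := by
  classical
  rw [imgLawAt_eq_imgPathLaw, fullLaw_eq_pathLaw, hitAt_eq_preimage]
  set E : Set (Fin (n + 1) → StateAction S A) := {z | (z (Fin.last n)).1 ∈ target ∧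
    ∀ t < Fin.last n, (z t).1 ∉ target ∧ (z t).1 ∉ avoid}
  rw [← measureReal_eq_measureReal_iff, ← (Set.toFinite E).coe_toFinset, ← sum_prefixProb_eq_real,
    ← sum_prefixProb_eq_real]
  exact Finset.sum_congr rfl fun z _ => prefixProb_imgPathLaw_of_le G π _ _ k hk z

/-- The tail of the geometric distribution. -/
lemma tsum_geometric_tail {p : ℝ} (hp0 : 0 ≤ p) (hp1 : p ≤ 1) {τ : PMF ℕ∞}
    (hτ : ∀ t : ℕ, τ (t : ℕ∞) = ENNReal.ofReal ((1 - p) ^ t * p)) (n : ℕ) :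
    ∑' k : ℕ∞, ({k | (n : ℕ∞) ≤ k} : Set ℕ∞).indicator τ k = ENNReal.ofReal ((1 - p) ^ n) := by
  classical
  have hq0 : 0 ≤ 1 - p := by linarith
  have hq1 : (1 - p) ^ n ≤ 1 := pow_le_one₀ hq0 (by linarith)
  have h1 : ∑' k : ℕ∞, ({k | (n : ℕ∞) ≤ k}ᶜ : Set ℕ∞).indicator τ k =
      ENNReal.ofReal (1 - (1 - p) ^ n) := by
    rw [tsum_eq_sum (s := (Finset.range n).map Nat.castEmbedding), Finset.sum_map]
    · have : ∀ t ∈ Finset.range n, ({k | (n : ℕ∞) ≤ k}ᶜ : Set ℕ∞).indicator τ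
          (Nat.castEmbedding t) = ENNReal.ofReal ((1 - p) ^ t * p) := by
        intro t ht
        rw [Set.indicator_of_mem (by simpa using ht)]
        exact hτ t
      rw [Finset.sum_congr rfl this, ← ENNReal.ofReal_sum_of_nonneg fun t _ => by positivity,
        ← Finset.sum_mul]
      congr 1
      have := geom_sum_mul (1 - p) n
      linarith
    · intro k hk
      refine Set.indicator_of_notMem (fun hk' => hk ?_) _
      have hlt : k < n := by simpa using hk'
      obtain ⟨j, rfl⟩ := ENat.ne_top_iff_exists.1 (hlt.trans_le le_top).ne
      simpa using hlt
  have h2 : ∑' k : ℕ∞, ({k | (n : ℕ∞) ≤ k} : Set ℕ∞).indicator τ k +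
      ∑' k : ℕ∞, ({k | (n : ℕ∞) ≤ k}ᶜ : Set ℕ∞).indicator τ k = 1 := by
    rw [← ENNReal.tsum_add, ← τ.tsum_coe]
    exact tsum_congr fun k => Set.indicator_self_add_compl_apply _ _ _
  rw [h1] at h2
  rw [ENNReal.eq_sub_of_add_eq ENNReal.ofReal_ne_top h2, ← ENNReal.ofReal_one,
    ← ENNReal.ofReal_sub _ (by linarith)]
  congr 1
  ring

/-- A path that succeeds at time `n` has the same probability under imaginary play, provided that
communication lasts beyond time `n`, which has probability `(1 - p) ^ (n + 1)`. -/
lemma tsum_hitAt_mul_le_imgLaw (target avoid : Set (∀ i, S i)) {p : ℝ} (hp0 : 0 ≤ p) (hp1 : p ≤ 1)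
    {τ : PMF ℕ∞} (hτ : ∀ t : ℕ, τ (t : ℕ∞) = ENNReal.ofReal ((1 - p) ^ t * p)) :
    ∑' n : ℕ, fullLaw G π (hitAt target avoid n) * ENNReal.ofReal ((1 - p) ^ (n + 1)) ≤
      imgLaw G π τ (Success target avoid) := by
  rw [imgLaw_apply _ _ _ (measurableSet_success _ _)]
  simp_rw [← tsum_geometric_tail hp0 hp1 hτ, ← ENNReal.tsum_mul_left]
  rw [ENNReal.tsum_comm]
  refine ENNReal.tsum_le_tsum fun k => ?_
  rw [success_eq_iUnion_hitAt, measure_iUnion (pairwise_disjoint_hitAt _ _)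
    (measurableSet_hitAt _ _), ← ENNReal.tsum_mul_left]
  refine ENNReal.tsum_le_tsum fun n => ?_
  by_cases hk : k ∈ {k : ℕ∞ | ((n + 1 : ℕ) : ℕ∞) ≤ k}
  · rw [Set.indicator_of_mem hk, imgLawAt_hitAt G π _ _ n hk, mul_comm]
  · rw [Set.indicator_of_notMem hk, mul_zero]
    exact zero_le

lemma hasSum_hitAt (target avoid : Set (∀ i, S i)) :
    HasSum (fun n => (fullLaw G π).real (hitAt target avoid n))
      ((fullLaw G π).real (Success target avoid)) := by
  rw [success_eq_iUnion_hitAt]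
  have h := measure_iUnion (μ := fullLaw G π) (pairwise_disjoint_hitAt target avoid)
    (measurableSet_hitAt _ _)
  have hne : ∑' n, fullLaw G π (hitAt target avoid n) ≠ ∞ := h ▸ measure_ne_top _ _
  rw [Measure.real, h, ENNReal.tsum_toReal_eq fun n => measure_ne_top _ _]
  exact ENNReal.hasSum_toReal hne

/-- Jensen's inequality for `x ↦ a ^ x` under the weights `w n / v` at `n + 1`, with the mean
replaced by its upper bound `l / v`. -/
lemma mul_rpow_le_of_hasSum {w : ℕ → ℝ} (hw : ∀ n, 0 ≤ w n) {v : ℝ} (hv : HasSum w v) {l r a : ℝ}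
    (ha0 : 0 ≤ a) (ha1 : a ≤ 1) (hl : ∀ m, ∑ n ∈ Finset.range m, w n * ((n : ℝ) + 1) ≤ l)
    (hr : ∀ m, ∑ n ∈ Finset.range m, w n * a ^ (n + 1) ≤ r) : v * a ^ (l / v) ≤ r := by
  have hr0 : 0 ≤ r := by simpa using hr 0
  rcases (hv.nonneg hw).eq_or_lt with h | hvpos
  · simpa [← h] using hr0
  have hvl : v ≤ l := by
    refine le_of_tendsto' hv.tendsto_sum_nat fun m => le_trans ?_ (hl m)
    refine Finset.sum_le_sum fun n _ => ?_
    have := hw n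
    nlinarith [Nat.cast_nonneg (α := ℝ) n]
  rcases ha0.eq_or_lt with rfl | hapos
  · rw [Real.zero_rpow (div_pos (hvpos.trans_le hvl) hvpos).ne', mul_zero]
    exact hr0
  set μ := l / v with hμ
  have hμv : μ * v = l := div_mul_cancel₀ _ hvpos.ne'
  have hlog : Real.log a ≤ 0 := Real.log_nonpos ha0 ha1
  have hpos : 0 < a ^ μ := Real.rpow_pos_of_pos hapos μ
  -- the tangent line of `x ↦ a ^ x` at `μ`
  have htan : ∀ n : ℕ, a ^ μ * (1 + Real.log a * ((n : ℝ) + 1 - μ)) ≤ a ^ (n + 1) := by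
    intro n
    have h1 : a ^ (n + 1) = a ^ μ * Real.exp (Real.log a * ((n : ℝ) + 1 - μ)) := by
      rw [← Real.rpow_def_of_pos hapos, ← Real.rpow_add hapos, ← Real.rpow_natCast]
      congr 1
      push_cast
      ring
    rw [h1]
    refine mul_le_mul_of_nonneg_left ?_ hpos.le
    rw [add_comm]
    exact Real.add_one_le_exp _
  have hm : ∀ m, a ^ μ *
      ((1 - μ * Real.log a) * ∑ n ∈ Finset.range m, w n + Real.log a * l) ≤ r := by
    intro m
    calc a ^ μ * ((1 - μ * Real.log a) * ∑ n ∈ Finset.range m, w n + Real.log a * l)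
        ≤ a ^ μ * ((1 - μ * Real.log a) * ∑ n ∈ Finset.range m, w n +
            Real.log a * ∑ n ∈ Finset.range m, w n * ((n : ℝ) + 1)) :=
          mul_le_mul_of_nonneg_left
            (add_le_add_right (mul_le_mul_of_nonpos_left (hl m) hlog) _) hpos.le
      _ = ∑ n ∈ Finset.range m, w n * (a ^ μ * (1 + Real.log a * ((n : ℝ) + 1 - μ))) := by
          rw [Finset.mul_sum, Finset.mul_sum, ← Finset.sum_add_distrib, Finset.mul_sum]
          exact Finset.sum_congr rfl fun n _ => by ring
      _ ≤ ∑ n ∈ Finset.range m, w n * a ^ (n + 1) :=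
          Finset.sum_le_sum fun n _ => mul_le_mul_of_nonneg_left (htan n) (hw n)
      _ ≤ r := hr m
  have hlim := le_of_tendsto' (((hv.tendsto_sum_nat.const_mul (1 - μ * Real.log a)).add_const
    (Real.log a * l)).const_mul (a ^ μ)) hm
  refine le_trans (le_of_eq ?_) hlim
  rw [← hμv]
  ring

lemma imgLaw_real_success_ge_mul {target avoid dead : Set (∀ i, S i)}
    (hdead : dead = deadReach G π target ∨ dead = deadReachAvoid G π target avoid)
    {p : ℝ} (hp0 : 0 ≤ p) (hp1 : p ≤ 1)
    {τ : PMF ℕ∞} (hτ : ∀ t : ℕ, τ (t : ℕ∞) = ENNReal.ofReal ((1 - p) ^ t * p)) :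
    (fullLaw G π).real (Success target avoid) * (1 - p) ^
        ((expectedLength G π target dead).toReal / (fullLaw G π).real (Success target avoid)) ≤
      (imgLaw G π τ).real (Success target avoid) := by
  have hq0 : 0 ≤ 1 - p := by linarith
  refine mul_rpow_le_of_hasSum (fun n => measureReal_nonneg) (hasSum_hitAt G π target avoid)
    hq0 (by linarith) (fun m => ?_) fun m => ?_
  · have h := (ENNReal.sum_le_tsum (Finset.range m)).trans
      (tsum_hitAt_mul_le_expectedLength G π (target := target) (avoid := avoid)
        fun s => success_eq_zero_of_mem_dead G π hdead)
    have h' := ENNReal.toReal_mono (expectedLength_ne_top G π hdead) h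
    rw [ENNReal.toReal_sum fun n _ => ENNReal.mul_ne_top (measure_ne_top _ _) (by simp)] at h'
    simp only [ENNReal.toReal_mul, Nat.cast_add, Nat.cast_one] at h'
    exact h'
  · have h := (ENNReal.sum_le_tsum (Finset.range m)).trans
      (tsum_hitAt_mul_le_imgLaw G π target avoid hp0 hp1 hτ)
    have h' := ENNReal.toReal_mono (measure_ne_top _ _) h
    rw [ENNReal.toReal_sum fun n _ => ENNReal.mul_ne_top (measure_ne_top _ _) (by simp)] at h'
    simpa [ENNReal.toReal_mul, Measure.real, ENNReal.toReal_ofReal, hq0] using h'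

end Values

end ImaginaryPlay

open ImaginaryPlay in
theorem mainTheorem2 {N : ℕ} {S : Fin N → Type*} {A : Fin N → Type*}
    [∀ i, Fintype (S i)] [∀ i, MeasurableSpace (S i)] [∀ i, MeasurableSingletonClass (S i)]
    [∀ i, Fintype (A i)] [∀ i, MeasurableSpace (A i)] [∀ i, MeasurableSingletonClass (A i)]
    (G : ∀ i, MDP (S i) (A i)) (π : (∀ i, S i) → PMF (∀ i, A i))
    (target avoid : Set (∀ i, S i))
    (p : ℝ) (hp0 : 0 ≤ p) (hp1 : p ≤ 1)
    (τ : PMF ℕ∞) (hτ : ∀ t : ℕ, τ (t : ℕ∞) = ENNReal.ofReal ((1 - p) ^ t * p))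
    (dead : Set (∀ i, S i))
    (hdead : dead = deadReach G π target ∨ dead = deadReachAvoid G π target avoid) :
    expectedLength G π target dead ≠ ∞ ∧
    (imgLaw G π τ).real (Success target avoid) ≥
      max
        ((fullLaw G π).real (Success target avoid)
          - Real.sqrt (1 - (EReal.exp (-(totalCorrelation G π))).toReal))
        ((fullLaw G π).real (Success target avoid)
          * (1 - p) ^ ((expectedLength G π target dead).toReal
              / (fullLaw G π).real (Success target avoid))) := by
  exact ⟨expectedLength_ne_top G π hdead, max_le (imgLaw_real_success_ge_sub G π target avoid τ)
    (imgLaw_real_success_ge_mul G π hdead hp0 hp1 hτ)⟩
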